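/- Let $A_1,\dots,A_n$ ($n\ge 1$) be complex $N\times N$ matrices such that $A_1$ is normal or, more generally, diagonalizable. Write $$\det(x_1A_1+\cdots+x_nA_n-x_{n+1}I)=c\,R_1^{m_1}\cdots R_s^{m_s},$$ where $c\neq 0$ is a constant, $m_j\ge 1$, and $R_1,\dots,R_s\in\mathbb C[x_1,\dots,x_{n+1}]$ are irreducible and pairwise non-proportional. Let $\lambda$ be an eigenvalue of $A_1$ and write $\hat x=(x_2,\dots,x_n)\in\mathbb C^{n-1}$. If $\lambda\ne 0$, put $\tilde R_j(x_1,\hat x)=R_j(x_1,\hat x,1)$, $p=(1/\lambda,0,\dots,0)\in\mathbb C^n$, call $z=x_1$ the distinguished coordinate and put $z_0=1/\lambda$. If $\lambda=0$, put $\tilde R_j(\hat x,x_{n+1})=R_j(1,\hat x,x_{n+1})$, $p=0\in\mathbb C^n$, call $z=x_{n+1}$ the distinguished coordinate and put $z_0=0$. Let $I_\lambda=\{j:\tilde R_j(p)=0\}$, and assume the regularity conditions a) $\dfrac{\partial\tilde R_j}{\partial z}(p)\neq 0$ for every $j\in I_\lambda$; b) for $i\neq j$ in $I_\lambda$ the gradients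 (with respect to all $n$ variables) of $\tilde R_i$ and $\tilde R_j$ at $p$ are not proportional. (For $\lambda=0$ these are the conditions usually denoted $\tilde a$), $\tilde b$).) Let $\mathcal U$ be the singular locus $\{F=0,\ dF=0\}$ of the reduced hypersurface $F:=\prod_{j\in I_\lambda}\tilde R_j=0$ in a small neighbourhood of $p$, and let $\tilde{\mathcal U}\subset\mathbb C^{n-1}$ be its image under the projection that forgets the coordinate $z$. Fix $\hat x\in\mathbb C^{n-1}$ such that the line $\{t\hat x:t\in\mathbb C\}$ is not tangent to any component of $\tilde{\mathcal U}$ at the origin, i.e. $\hat x$ does not belong to the tangent cone of $\tilde{\mathcal U}$ at $0$. Let $j\in I_\lambda$. Then there is an analytic function $\varphi$ near $0\in\mathbb C^{n-1}$ with $\varphi(0)=z_0$ whose graph $z=\varphi(\hat v)$ lies in $\{\tilde R_j=0\}$. For any such $\varphi$, the point of this graph over $t\hat x$ is not in $\mathcal U$ for all sufficiently small $t\ne 0$. For such $t$ let $$P_{j,\lambda}(t\hat x)=\frac1{2\pi i}\oint_{|w-1|=\delta}\Bigl(w-\varphi(t\hat x)A_1-\sum_{l=2}^n t x_lA_l\Bigr)^{-1}dw\qquad(\lambda\neq0),$$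 $$P_{j,0}(t\hat x)=\frac1{2\pi i}\oint_{|w|=\delta}\Bigl(w+\varphi(t\hat x)-A_1-\sum_{l=2}^n t x_lA_l\Bigr)^{-1}dw\qquad(\lambda=0),$$ where $\delta=\delta(t)>0$ is any number such that the closed disk $|w-1|\le\delta$ contains no eigenvalue other than $1$ of $\varphi(t\hat x)A_1+\sum_{l\ge2} t x_lA_l$ (respectively, $|w|\le\delta$ contains no eigenvalue other than $0$ of $A_1+\sum_{l\ge2} t x_lA_l-\varphi(t\hat x)I$). Then $t\mapsto P_{j,\lambda}(t\hat x)$ extends to an analytic matrix-valued function of $t$ in a neighbourhood of $t=0$. In particular the limit $\mathcal P_{j,\lambda}(\hat x)=\lim_{t\to0}P_{j,\lambda}(t\hat x)$ exists, and it is a projection: $\mathcal P_{j,\lambda}(\hat x)^2=\mathcal P_{j,\lambda}(\hat x)$. -/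

import Mathlib

open MvPolynomial Filter Topology

noncomputable section

namespace JointSpectrum

/-- The homogeneous polynomial `det (x₁ A₁ + ⋯ + xₙ Aₙ - xₙ₊₁ I)`, where `n = k + 1`.
The matrix `A₁` is `A 0`, the variable `xᵢ₊₁` is `X i`, and the last variable is `xₙ₊₁`. -/
def pencilPoly {k N : ℕ} (A : Fin (k + 1) → Matrix (Fin N) (Fin N) ℂ) :
    MvPolynomial (Fin (k + 2)) ℂ :=
  ((∑ i : Fin (k + 1),
      (X i.castSucc : MvPolynomial (Fin (k + 2)) ℂ) • (A i).map (fun a => C a)) -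
    (X (Fin.last (k + 1)) : MvPolynomial (Fin (k + 2)) ℂ) •
      (1 : Matrix (Fin N) (Fin N) (MvPolynomial (Fin (k + 2)) ℂ))).det

/-- `F = c · R₁ ^ m₁ ⋯ Rₛ ^ mₛ` is the factorization of `F` into pairwise different (that is,
non-associated) irreducible polynomials with positive exponents, `c` being a unit. -/
structure IsIrreducibleFactorization {σ : Type} {s : ℕ} (F : MvPolynomial σ ℂ)
    (R : Fin s → MvPolynomial σ ℂ) (m : Fin s → ℕ) : Prop where
  irreducible : ∀ j, Irreducible (R j)
  exponent_pos : ∀ j, 0 < m j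
  not_associated : ∀ i j, i ≠ j → ¬ Associated (R i) (R j)
  associated_prod : Associated F (∏ j, R j ^ m j)

/-- The polynomial `(x₁, …, xₙ) ↦ R (x₁, …, xₙ, 1)`. -/
def chartLast {k : ℕ} (R : MvPolynomial (Fin (k + 2)) ℂ) : MvPolynomial (Fin (k + 1)) ℂ :=
  aeval (Fin.snoc (α := fun _ => MvPolynomial (Fin (k + 1)) ℂ) (fun i => X i) 1) R

/-- The polynomial `(x₂, …, xₙ₊₁) ↦ R (1, x₂, …, xₙ₊₁)`. -/
def chartFirst {k : ℕ} (R : MvPolynomial (Fin (k + 2)) ℂ) : MvPolynomial (Fin (k + 1)) ℂ :=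
  aeval (Fin.cons (α := fun _ => MvPolynomial (Fin (k + 1)) ℂ) 1 (fun i => X i)) R

/-- The point of `ℂ ^ (k + 1)` whose `d`-th coordinate is `z` and whose remaining coordinates are,
in order, those of `v`. -/
def point {k : ℕ} (d : Fin (k + 1)) (z : ℂ) (v : Fin k → ℂ) : Fin (k + 1) → ℂ :=
  d.insertNth (α := fun _ => ℂ) z v

/-- The orthogonal projection of `ℂ ^ (k + 1)` onto the hyperplane where the `d`-th coordinate
vanishes, that coordinate being dropped. -/
def proj {k : ℕ} (d : Fin (k + 1)) (x : Fin (k + 1) → ℂ) : Fin k → ℂ :=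
  d.removeNth (α := fun _ => ℂ) x

/-- The vector of all partial derivatives of `f` at `p`. -/
def gradAt {k : ℕ} (f : MvPolynomial (Fin (k + 1)) ℂ) (p : Fin (k + 1) → ℂ) : Fin (k + 1) → ℂ :=
  fun i => eval p (pderiv i f)

/-- The regularity conditions at the point `p`, with distinguished coordinate `d`, for the
components `{f j = 0}` of a hypersurface. Only the components passing through `p` matter. -/
structure Regularity {k s : ℕ} (d : Fin (k + 1)) (f : Fin s → MvPolynomial (Fin (k + 1)) ℂ)
    (p : Fin (k + 1) → ℂ) : Prop where
  deriv_ne_zero : ∀ j, eval p (f j) = 0 → eval p (pderiv d (f j)) ≠ 0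
  not_proportional : ∀ i j, i ≠ j → eval p (f i) = 0 → eval p (f j) = 0 →
    LinearIndependent ℂ ![gradAt (f i) p, gradAt (f j) p]

open Classical in
/-- The product of those `f j` that vanish at `p`. -/
def localEquation {k s : ℕ} (f : Fin s → MvPolynomial (Fin (k + 1)) ℂ) (p : Fin (k + 1) → ℂ) :
    MvPolynomial (Fin (k + 1)) ℂ :=
  ∏ j ∈ Finset.univ.filter (fun j => eval p (f j) = 0), f j

/-- The singular locus of the hypersurface with (reduced) equation `F = 0`. -/
def singularLocus {k : ℕ} (F : MvPolynomial (Fin (k + 1)) ℂ) : Set (Fin (k + 1) → ℂ) :=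
  {x | eval x F = 0 ∧ gradAt F x = 0}

/-- The line `ℂ v` is tangent at the origin to a component of the germ at the origin of the
projection of the singular locus of `{∏ f j = 0} ∩ O` (product over the components through the base
point `p`), `O` being a small neighbourhood of `p`. The tangent cone of the projected locus is the
union of the tangent cones of its components. -/
def IsTangentDirection {k s : ℕ} (d : Fin (k + 1)) (f : Fin s → MvPolynomial (Fin (k + 1)) ℂ)
    (p : Fin (k + 1) → ℂ) (v : Fin k → ℂ) : Prop :=
  ∀ O ∈ 𝓝 p, v ∈ tangentConeAt ℂ (proj d '' (singularLocus (localEquation f p) ∩ O)) 0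

/-- `φ` is an analytic solution near the origin of `f (φ(v), v) = 0` with `φ(0) = z₀`, the `d`-th
coordinate being expressed through the others. -/
structure IsBranch {k : ℕ} (d : Fin (k + 1)) (f : MvPolynomial (Fin (k + 1)) ℂ) (z₀ : ℂ)
    (φ : (Fin k → ℂ) → ℂ) : Prop where
  analytic : AnalyticAt ℂ φ 0
  map_zero : φ 0 = z₀
  eval_eq_zero : ∀ᶠ v in 𝓝 (0 : Fin k → ℂ), eval (point d (φ v) v) f = 0

/-- `A` is diagonalizable. -/
def IsDiagonalizable {N : ℕ} (A : Matrix (Fin N) (Fin N) ℂ) : Prop :=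
  ∃ (S : Matrix (Fin N) (Fin N) ℂ) (a : Fin N → ℂ),
    IsUnit S.det ∧ A = S * Matrix.diagonal a * S⁻¹

/-- The closed disk of radius `δ` about `μ` contains no eigenvalue of `T` different from `μ`. -/
def IsIsolatingRadius {N : ℕ} (T : Matrix (Fin N) (Fin N) ℂ) (μ : ℂ) (δ : ℝ) : Prop :=
  0 < δ ∧ ∀ w ∈ spectrum ℂ T, w ≠ μ → δ < dist w μ

/-- `(2πi)⁻¹ ∮ (w - T)⁻¹ dw` over the circle `|w - μ| = δ`, computed entry by entry. -/
def rieszProjection {N : ℕ} (T : Matrix (Fin N) (Fin N) ℂ) (μ : ℂ) (δ : ℝ) :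
    Matrix (Fin N) (Fin N) ℂ :=
  Matrix.of fun a b => (2 * Real.pi * Complex.I)⁻¹ *
    ∮ w in C(μ, δ), (w • (1 : Matrix (Fin N) (Fin N) ℂ) - T)⁻¹ a b

/-- The Riesz projection of `T t` at its eigenvalue `μ`, which is defined for small `t ≠ 0` by any
circle that isolates `μ`, extends to an analytic function `Q` of `t` near `0`; its limit `Q 0` as
`t → 0` is a projection. -/
def RieszProjectionExtends {N : ℕ} (T : ℂ → Matrix (Fin N) (Fin N) ℂ) (μ : ℂ) : Prop :=
  ∃ Q : ℂ → Matrix (Fin N) (Fin N) ℂ,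
    (∀ a b, AnalyticAt ℂ (fun t => Q t a b) 0) ∧
    (∀ᶠ t in 𝓝[≠] (0 : ℂ), ∀ δ : ℝ, IsIsolatingRadius (T t) μ δ →
      rieszProjection (T t) μ δ = Q t) ∧
    IsIdempotentElem (Q 0)

end JointSpectrum

end

/-!
Write `T t` for the pencil along the branch `φ` over the line `t • xhat`, and `μ` for its persistent
eigenvalue (`1` or `0`). The Riesz projection of an analytic family may have a pole at `t = 0` only
if further eigenvalues converge to `μ` too fast or if `μ` is not a semisimple eigenvalue of `T 0`;
both are excluded here.

*The gap.* The eigenvalues of `T t` near `μ` are read off from the components of the determinantal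
hypersurface: `μ + w` is an eigenvalue exactly if a point `b (t, w)`, a deformation of the point
`b (t, 0)` of the branch, lies on some component. On the component of the branch itself, `w = 0` is
the only solution near the origin, since `b (0, ·)` is transversal to it. On another component the
solutions are of order at least `t`, unless the branch is tangent to that component at the base
point. In the latter case the tangent vector lies in the tangent space of the transversal
intersection of the two components, which consists of singular points, so that `xhat` would be a
tangent direction of the projected singular locus (`isTangentDirection_of_gradCLM_eq_zero`).
Hence `‖w‖ ≥ c * ‖t‖` for all eigenvalues `μ + w ≠ μ` of `T t` (`exists_gap`).

*The reduction.* Write `T t - μ = M₀ + t • M₁ t`. Since `A 0` is normal or diagonalizable, `M₀` has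
a kernel idempotent `E`. On the isolating circle `w = μ + t * v`, `‖v‖ = r < c`, the matrix
`t * v - (M₀ + t • M₁ t)` is the product of `t • E + (1 - E)` and a matrix `K (t, v)` that remains
invertible at `t = 0` (`smul_inv_eq_of_reduction`), and so the integral over the circle is analytic
at `t = 0` (`rieszProjectionExtends_of_gap`). Its value there is idempotent by continuity.
-/

noncomputable section

namespace JointSpectrum

section

/-! ### Resolvents and Riesz projections -/

section Analytic

variable {E : Type*} [NormedAddCommGroup E] [NormedSpace ℂ E] {N : ℕ}

theorem analyticAt_det {M : E → Matrix (Fin N) (Fin N) ℂ} {x : E}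
    (h : ∀ a b, AnalyticAt ℂ (fun y => M y a b) x) : AnalyticAt ℂ (fun y => (M y).det) x := by
  simp only [Matrix.det_apply']
  exact Finset.analyticAt_fun_sum _ fun σ _ =>
    analyticAt_const.mul (Finset.analyticAt_fun_prod _ fun i _ => h _ _)

theorem analyticAt_mul_apply {M M' : E → Matrix (Fin N) (Fin N) ℂ} {x : E}
    (h : ∀ a b, AnalyticAt ℂ (fun y => M y a b) x)
    (h' : ∀ a b, AnalyticAt ℂ (fun y => M' y a b) x) (a b : Fin N) :
    AnalyticAt ℂ (fun y => (M y * M' y) a b) x := by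
  simp only [Matrix.mul_apply]
  exact Finset.analyticAt_fun_sum _ fun c _ => (h a c).mul (h' c b)

theorem analyticAt_inv_apply {M : E → Matrix (Fin N) (Fin N) ℂ} {x : E}
    (h : ∀ a b, AnalyticAt ℂ (fun y => M y a b) x) (hx : (M x).det ≠ 0) (a b : Fin N) :
    AnalyticAt ℂ (fun y => (M y)⁻¹ a b) x := by
  simp only [Matrix.inv_def, Matrix.smul_apply, Ring.inverse_eq_inv', smul_eq_mul,
    Matrix.adjugate_apply]
  refine ((analyticAt_det h).inv hx).mul (analyticAt_det fun c d => ?_)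
  simp only [Matrix.updateRow_apply]
  split_ifs
  · exact analyticAt_const
  · exact h c d

end Analytic

variable {N : ℕ} {T : Matrix (Fin N) (Fin N) ℂ} {μ : ℂ} {δ : ℝ}

theorem mem_spectrum_iff_det {w : ℂ} :
    w ∈ spectrum ℂ T ↔ (w • (1 : Matrix (Fin N) (Fin N) ℂ) - T).det = 0 := by
  rw [spectrum.mem_iff, Matrix.isUnit_iff_isUnit_det, isUnit_iff_ne_zero, not_not,
    Algebra.algebraMap_eq_smul_one]

theorem analyticAt_resolvent_apply {w : ℂ} (hw : w ∉ spectrum ℂ T) (a b : Fin N) :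
    AnalyticAt ℂ (fun z : ℂ => (z • (1 : Matrix (Fin N) (Fin N) ℂ) - T)⁻¹ a b) w := by
  refine analyticAt_inv_apply (M := fun z : ℂ => z • (1 : Matrix (Fin N) (Fin N) ℂ) - T)
    (fun c d => ?_) (mt mem_spectrum_iff_det.2 hw) a b
  simp only [Matrix.sub_apply, Matrix.smul_apply, smul_eq_mul]
  exact (analyticAt_id.mul analyticAt_const).sub analyticAt_const

theorem IsIsolatingRadius.notMem_spectrum (h : IsIsolatingRadius T μ δ) {w : ℂ} (hne : w ≠ μ)
    (hw : dist w μ ≤ δ) : w ∉ spectrum ℂ T := fun hs => (h.2 w hs hne).not_ge hw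

theorem IsIsolatingRadius.mono (h : IsIsolatingRadius T μ δ) {r : ℝ} (hr : 0 < r) (hrδ : r ≤ δ) :
    IsIsolatingRadius T μ r :=
  ⟨hr, fun w hw hne => hrδ.trans_lt (h.2 w hw hne)⟩

theorem IsIsolatingRadius.notMem_of_mem_sphere (h : IsIsolatingRadius T μ δ) {w : ℂ}
    (hw : w ∈ Metric.sphere μ δ) : w ∉ spectrum ℂ T :=
  h.notMem_spectrum (Metric.ne_of_mem_sphere hw h.1.ne') (Metric.mem_sphere.1 hw).le

theorem IsIsolatingRadius.continuousOn_resolvent (h : IsIsolatingRadius T μ δ) (a b : Fin N) :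
    ContinuousOn (fun z : ℂ => (z • (1 : Matrix (Fin N) (Fin N) ℂ) - T)⁻¹ a b)
      (Metric.sphere μ δ) := fun _ hw =>
  (analyticAt_resolvent_apply (h.notMem_of_mem_sphere hw) a b).continuousAt.continuousWithinAt

/-- By Cauchy's theorem in an annulus, the Riesz projection does not depend on the isolating
circle. -/
theorem rieszProjection_eq_of_le (h : IsIsolatingRadius T μ δ) {r : ℝ} (hr : 0 < r) (hrδ : r ≤ δ) :
    rieszProjection T μ δ = rieszProjection T μ r := by
  ext a b
  simp only [rieszProjection, Matrix.of_apply]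
  congr 1
  have key : ∀ w ∈ Metric.closedBall μ δ \ Metric.ball μ r, w ∉ spectrum ℂ T := fun w hw => by
    refine h.notMem_spectrum ?_ (Metric.mem_closedBall.1 hw.1)
    rintro rfl
    exact hw.2 (Metric.mem_ball_self hr)
  refine Complex.circleIntegral_eq_of_differentiable_on_annulus_off_countable hr hrδ
    Set.countable_empty (fun w hw => ?_) fun w hw => ?_
  · exact (analyticAt_resolvent_apply (key w hw) a b).continuousAt.continuousWithinAt
  · exact (analyticAt_resolvent_apply (key w ⟨Metric.ball_subset_closedBall hw.1.1,
      fun h' => hw.1.2 (Metric.ball_subset_closedBall h')⟩) a b).differentiableAt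

theorem rieszProjection_eq (h : IsIsolatingRadius T μ δ) {r : ℝ} (hr : IsIsolatingRadius T μ r) :
    rieszProjection T μ δ = rieszProjection T μ r := by
  rcases le_total r δ with hle | hle
  · exact rieszProjection_eq_of_le h hr.1 hle
  · exact (rieszProjection_eq_of_le hr h.1 hle).symm

/-- The resolvent identity. -/
theorem resolvent_mul_resolvent {w u : ℂ} (hw : w ∉ spectrum ℂ T) (hu : u ∉ spectrum ℂ T)
    (huw : u ≠ w) :
    (w • (1 : Matrix (Fin N) (Fin N) ℂ) - T)⁻¹ * (u • 1 - T)⁻¹ =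
      (u - w)⁻¹ • ((w • 1 - T)⁻¹ - (u • 1 - T)⁻¹) := by
  have h1 := Matrix.nonsing_inv_mul _ (isUnit_iff_ne_zero.2 (mt mem_spectrum_iff_det.2 hw))
  have h2 := Matrix.mul_nonsing_inv _ (isUnit_iff_ne_zero.2 (mt mem_spectrum_iff_det.2 hu))
  set A := (w • (1 : Matrix (Fin N) (Fin N) ℂ) - T)⁻¹
  set B := (u • (1 : Matrix (Fin N) (Fin N) ℂ) - T)⁻¹
  have h3 : A - B = (u - w) • (A * B) := by
    calc A - B = A * ((u • 1 - T) * B) - (A * (w • 1 - T)) * B := by rw [h1, h2]; simp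
      _ = (u - w) • (A * B) := by
        simp only [sub_mul, mul_sub, smul_mul_assoc, mul_smul_comm, mul_one, one_mul, sub_smul,
          mul_assoc]
        abel
  rw [h3, smul_smul, inv_mul_cancel₀ (sub_ne_zero.2 huw), one_smul]

/-- With the outer circle for one factor and a smaller circle for the other, the resolvent
identity splits the double integral into the Riesz projection and the integral over the inner
circle of a function holomorphic inside the outer one, which vanishes. -/
theorem isIdempotentElem_rieszProjection (h : IsIsolatingRadius T μ δ) :
    IsIdempotentElem (rieszProjection T μ δ) := by
  have hδ := h.1
  have hr : 0 < δ / 2 := by positivity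
  have hrδ : δ / 2 < δ := by linarith
  have h' := h.mono hr hrδ.le
  set G : ℂ → Matrix (Fin N) (Fin N) ℂ := fun w => (w • (1 : Matrix (Fin N) (Fin N) ℂ) - T)⁻¹
    with hG
  have hci : ∀ a b, CircleIntegrable (fun w => G w a b) μ δ := fun a b =>
    (h.continuousOn_resolvent a b).circleIntegrable hδ.le
  have hci' : ∀ a b, CircleIntegrable (fun w => G w a b) μ (δ / 2) := fun a b =>
    (h'.continuousOn_resolvent a b).circleIntegrable hr.le
  set H : Fin N → Fin N → ℂ → ℂ := fun a b w =>
    (2 * Real.pi * Complex.I)⁻¹ • ∮ u in C(μ, δ), (u - w)⁻¹ • G u a b with hH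
  have hHan : ∀ a b, AnalyticOnNhd ℂ (H a b) (Metric.ball μ δ) := by
    intro a b
    obtain ⟨ρ, hρ⟩ : ∃ ρ : NNReal, (ρ : ℝ) = δ := ⟨⟨δ, hδ.le⟩, rfl⟩
    have := (hasFPowerSeriesOn_cauchy_integral (R := ρ) (hρ ▸ hci a b)
      (by rw [← NNReal.coe_pos, hρ]; exact hδ)).analyticOnNhd
    rwa [Metric.eball_coe, hρ] at this
  have hsub : Metric.closedBall μ (δ / 2) ⊆ Metric.ball μ δ := Metric.closedBall_subset_ball hrδ
  have hH0 : ∀ a b, (∮ w in C(μ, δ / 2), H a b w) = 0 := fun a b =>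
    Complex.circleIntegral_eq_zero_of_differentiable_on_off_countable hr.le Set.countable_empty
      (fun w hw => (hHan a b w (hsub hw)).continuousAt.continuousWithinAt)
      fun w hw => (hHan a b w (hsub (Metric.ball_subset_closedBall hw.1))).differentiableAt
  have hpi : (2 * Real.pi * Complex.I : ℂ) ≠ 0 := Complex.two_pi_I_ne_zero
  have step : ∀ w ∈ Metric.sphere μ (δ / 2), ∀ a b,
      (G w * rieszProjection T μ δ) a b = G w a b - H a b w := by
    intro w hw a b
    have hwb : w ∈ Metric.ball μ δ := hsub (Metric.sphere_subset_closedBall hw)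
    have hne : ∀ u ∈ Metric.sphere μ δ, u ≠ w := by
      rintro u hu rfl
      exact (Metric.mem_ball.1 hwb).ne (Metric.mem_sphere.1 hu)
    have hcinv : ContinuousOn (fun u : ℂ => (u - w)⁻¹) (Metric.sphere μ δ) :=
      ContinuousOn.inv₀ (by fun_prop) fun u hu => sub_ne_zero.2 (hne u hu)
    have e1 : ∀ c, G w a c * ∮ u in C(μ, δ), G u c b = ∮ u in C(μ, δ), G w a c * G u c b :=
      fun c => (circleIntegral.integral_const_mul _ _ _ _).symm
    rw [Matrix.mul_apply]
    simp only [rieszProjection, Matrix.of_apply]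
    calc ∑ c, G w a c * ((2 * Real.pi * Complex.I)⁻¹ * ∮ u in C(μ, δ), G u c b)
        = (2 * Real.pi * Complex.I)⁻¹ * ∑ c, ∮ u in C(μ, δ), G w a c * G u c b := by
          rw [Finset.mul_sum]
          refine Finset.sum_congr rfl fun c _ => ?_
          rw [← e1]; ring
      _ = (2 * Real.pi * Complex.I)⁻¹ * ∮ u in C(μ, δ), ∑ c, G w a c * G u c b := by
          rw [circleIntegral.integral_fun_sum]
          exact fun c _ => ((hci c b).const_smul (a := G w a c))
      _ = (2 * Real.pi * Complex.I)⁻¹ *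
            ∮ u in C(μ, δ), ((u - w)⁻¹ * G w a b - (u - w)⁻¹ * G u a b) := by
          congr 1
          refine circleIntegral.integral_congr hδ.le fun u hu => ?_
          have := congrFun (congrFun (resolvent_mul_resolvent (h'.notMem_of_mem_sphere hw)
            (h.notMem_of_mem_sphere hu) (hne u hu)) a) b
          rw [Matrix.mul_apply] at this
          simp only [hG]
          rw [this]
          simp only [Matrix.smul_apply, Matrix.sub_apply, smul_eq_mul]
          ring
      _ = G w a b - H a b w := by
          rw [circleIntegral.integral_sub]
          · have : (∮ u in C(μ, δ), (u - w)⁻¹ * G w a b) = 2 * Real.pi * Complex.I * G w a b := by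
              have := circleIntegral.integral_smul_const (fun u : ℂ => (u - w)⁻¹) (G w a b) μ δ
              simp only [smul_eq_mul] at this
              rw [this, circleIntegral.integral_sub_inv_of_mem_ball hwb]
            rw [this, mul_sub, ← mul_assoc, inv_mul_cancel₀ hpi, one_mul]
            simp [hH]
          · exact (hcinv.mul continuousOn_const).circleIntegrable hδ.le
          · exact (hcinv.mul (h.continuousOn_resolvent a b)).circleIntegrable hδ.le
  have hprod : rieszProjection T μ (δ / 2) * rieszProjection T μ δ =
      rieszProjection T μ (δ / 2) := by
    ext a b
    set P := rieszProjection T μ δ with hP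
    have e1 : ∀ c, (∮ w in C(μ, δ / 2), G w a c) * P c b =
        ∮ w in C(μ, δ / 2), G w a c * P c b := fun c =>
      (circleIntegral.integral_smul_const (fun w => G w a c) (P c b) μ (δ / 2)).symm
    rw [Matrix.mul_apply]
    simp only [rieszProjection, Matrix.of_apply]
    calc ∑ c, ((2 * Real.pi * Complex.I)⁻¹ * ∮ w in C(μ, δ / 2), G w a c) * P c b
        = (2 * Real.pi * Complex.I)⁻¹ * ∑ c, ∮ w in C(μ, δ / 2), G w a c * P c b := by
          rw [Finset.mul_sum]
          refine Finset.sum_congr rfl fun c _ => ?_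
          rw [← e1]; ring
      _ = (2 * Real.pi * Complex.I)⁻¹ * ∮ w in C(μ, δ / 2), ∑ c, G w a c * P c b := by
          rw [circleIntegral.integral_fun_sum]
          intro c _
          exact ((h'.continuousOn_resolvent a c).mul continuousOn_const).circleIntegrable hr.le
      _ = (2 * Real.pi * Complex.I)⁻¹ * ∮ w in C(μ, δ / 2), (G w a b - H a b w) := by
          congr 1
          refine circleIntegral.integral_congr hr.le fun w hw => ?_
          have := step w hw a b
          rwa [Matrix.mul_apply] at this
      _ = (2 * Real.pi * Complex.I)⁻¹ * ∮ w in C(μ, δ / 2), G w a b := by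
          rw [circleIntegral.integral_sub (hci' a b), hH0, sub_zero]
          exact ContinuousOn.circleIntegrable hr.le fun w hw =>
            (hHan a b w (hsub (Metric.sphere_subset_closedBall hw))).continuousAt.continuousWithinAt
  rw [← rieszProjection_eq_of_le h hr hrδ.le] at hprod
  exact hprod

/-- Substitution `w = c + t * v` in a circle integral; a rotation of the circle by the argument of
`t` does not change the integral. -/
theorem circleIntegral_comp_add_mul (f : ℂ → ℂ) (c : ℂ) (r : ℝ) (t : ℂ) :
    (∮ w in C(c, r * ‖t‖), f w) = ∮ v in C(0, r), t * f (c + t * v) := by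
  set g : ℝ → ℂ := fun θ => deriv (circleMap c (r * ‖t‖)) θ • f (circleMap c (r * ‖t‖) θ) with hg
  have hper : Function.Periodic g (2 * Real.pi) := by
    intro θ
    simp only [hg, deriv_circleMap, periodic_circleMap _ _ θ]
  have key : ∀ θ : ℝ, circleMap 0 (r * ‖t‖) (θ + t.arg) = t * circleMap 0 r θ := by
    intro θ
    conv_rhs => rw [← Complex.norm_mul_exp_arg_mul_I t]
    simp only [circleMap, zero_add, Complex.ofReal_mul, Complex.ofReal_add, add_mul,
      Complex.exp_add]
    ring
  have key' : ∀ θ : ℝ, circleMap c (r * ‖t‖) (θ + t.arg) = c + t * circleMap 0 r θ := by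
    intro θ
    rw [← key]; simp [circleMap]
  calc (∮ w in C(c, r * ‖t‖), f w) = ∫ θ in (0 : ℝ)..(0 + 2 * Real.pi), g θ := by
        simp [circleIntegral, hg]
    _ = ∫ θ in (0 + t.arg)..(2 * Real.pi + t.arg), g θ := by
        rw [hper.intervalIntegral_add_eq 0 t.arg]
        congr 1 <;> ring
    _ = ∫ θ in (0 : ℝ)..(2 * Real.pi), g (θ + t.arg) := by
        rw [intervalIntegral.integral_comp_add_right]
    _ = ∮ v in C(0, r), t * f (c + t * v) := by
        simp only [circleIntegral, hg, deriv_circleMap, key, key', smul_eq_mul]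
        congr 1
        ext θ
        ring

/-- A circle integral depending on a parameter is analytic at a parameter value over which the
integrand is jointly analytic along the circle: differentiate under the integral. -/
theorem analyticAt_circleIntegral {g : ℂ × ℂ → ℂ} {t₀ c : ℂ} {r : ℝ} (hr : 0 ≤ r)
    (hg : ∀ v ∈ Metric.sphere c r, AnalyticAt ℂ g (t₀, v)) :
    AnalyticAt ℂ (fun t => ∮ v in C(c, r), g (t, v)) t₀ := by
  have hO : IsOpen {x | AnalyticAt ℂ g x} := isOpen_analyticAt ℂ g
  obtain ⟨U, V, hU, -, h0, hV, hUV⟩ := generalized_tube_lemma (isCompact_singleton (x := t₀))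
    (isCompact_sphere c r) hO (by
      rintro ⟨a, b⟩ ⟨rfl, hb⟩
      exact hg b hb)
  obtain ⟨ρ, hρ, hρU⟩ := Metric.nhds_basis_closedBall.mem_iff.1
    (hU.mem_nhds (h0 (Set.mem_singleton t₀)))
  have hA : ∀ t ∈ Metric.closedBall t₀ ρ, ∀ v ∈ Metric.sphere c r, AnalyticAt ℂ g (t, v) :=
    fun t ht v hv => hUV (Set.mk_mem_prod (hρU ht) (hV hv))
  have hcm : ∀ θ : ℝ, circleMap c r θ ∈ Metric.sphere c r := circleMap_mem_sphere c hr
  -- the partial derivative in the parameter, bounded on a compact set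
  set g' : ℂ × ℂ → ℂ := fun x => fderiv ℂ g x (1, 0) with hg'
  have hg'c : ContinuousOn g' (Metric.closedBall t₀ ρ ×ˢ Metric.sphere c r) := fun x hx =>
    ((((hA x.1 hx.1 x.2 hx.2).fderiv).continuousAt).clm_apply
      continuousAt_const).continuousWithinAt
  obtain ⟨C, hC⟩ := ((isCompact_closedBall t₀ ρ).prod
    (isCompact_sphere c r)).exists_bound_of_continuousOn hg'c
  have hcont : ∀ t ∈ Metric.closedBall t₀ ρ, Continuous fun θ : ℝ => g (t, circleMap c r θ) :=
    fun t ht => continuous_iff_continuousAt.2 fun θ =>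
      ContinuousAt.comp (f := fun θ : ℝ => (t, circleMap c r θ)) (hA t ht _ (hcm θ)).continuousAt
        (by fun_prop)
  have hcont' : ∀ t ∈ Metric.closedBall t₀ ρ, Continuous fun θ : ℝ => g' (t, circleMap c r θ) :=
    fun t ht => hg'c.comp_continuous (by fun_prop) fun θ => ⟨ht, hcm θ⟩
  rw [Complex.analyticAt_iff_eventually_differentiableAt]
  filter_upwards [Metric.ball_mem_nhds t₀ hρ] with t ht
  have hsub := Metric.ball_subset_closedBall (x := t₀) (ε := ρ)
  have hdc : Continuous fun θ : ℝ => deriv (circleMap c r) θ := by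
    simp only [deriv_circleMap]; fun_prop
  refine (intervalIntegral.hasDerivAt_integral_of_dominated_loc_of_deriv_le
    (F := fun t θ => deriv (circleMap c r) θ • g (t, circleMap c r θ))
    (F' := fun t θ => deriv (circleMap c r) θ • g' (t, circleMap c r θ))
    (bound := fun _ => r * C) (Metric.isOpen_ball.mem_nhds ht) ?_ ?_ ?_ ?_ ?_ ?_).2.differentiableAt
  · filter_upwards [Metric.isOpen_ball.mem_nhds ht] with s hs
    exact (hdc.smul (hcont s (hsub hs))).aestronglyMeasurable
  · exact (hdc.smul (hcont t (hsub ht))).intervalIntegrable _ _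
  · exact (hdc.smul (hcont' t (hsub ht))).aestronglyMeasurable
  · refine Eventually.of_forall fun θ _ s hs => ?_
    rw [norm_smul]
    have h1 : ‖deriv (circleMap c r) θ‖ = r := by simp [deriv_circleMap, abs_of_nonneg hr]
    rw [h1]
    exact mul_le_mul_of_nonneg_left (hC _ ⟨hsub hs, hcm θ⟩) hr
  · exact intervalIntegrable_const
  · refine Eventually.of_forall fun θ _ s hs => ?_
    have h1 := (hA s (hsub hs) _ (hcm θ)).differentiableAt.hasFDerivAt
    have h2 : HasDerivAt (fun s : ℂ => (s, circleMap c r θ)) ((1 : ℂ), (0 : ℂ)) s :=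
      (hasDerivAt_id s).prodMk (hasDerivAt_const s _)
    exact (h1.comp_hasDerivAt s h2).const_smul (deriv (circleMap c r) θ)

end

section

/-! ### Reduction at a semisimple eigenvalue -/

variable {N : ℕ}

/-- If the kernels of `M` and `M ^ 2` coincide, there is an idempotent `E`, the projection onto the
kernel of `M` along its range, and `E - M` is invertible. It is obtained as `q(M) / q(0)`, where
`X ^ m * q` is the characteristic polynomial of `M` and `q(0) ≠ 0`. -/
theorem exists_kernel_idempotent (M : Matrix (Fin N) (Fin N) ℂ)
    (hM : ∀ v, M.mulVec (M.mulVec v) = 0 → M.mulVec v = 0) :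
    ∃ E : Matrix (Fin N) (Fin N) ℂ, E * E = E ∧ E * M = 0 ∧ (E - M).det ≠ 0 := by
  obtain ⟨q, hq, hndvd⟩ := Polynomial.exists_eq_pow_rootMultiplicity_mul_and_not_dvd M.charpoly
    M.charpoly_monic.ne_zero 0
  rw [map_zero, sub_zero] at hq hndvd
  have hq0 : q.eval 0 ≠ 0 := by
    rwa [Ne, ← Polynomial.coeff_zero_eq_eval_zero, ← Polynomial.X_dvd_iff]
  have hch : M ^ (M.charpoly.rootMultiplicity 0) * Polynomial.aeval M q = 0 := by
    have := M.aeval_self_charpoly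
    rw [hq] at this
    simpa using this
  have hpow : ∀ m : ℕ, ∀ v, (M ^ m).mulVec v = 0 → M.mulVec v = 0 := by
    intro m
    induction m with
    | zero =>
      intro v hv
      rw [pow_zero, Matrix.one_mulVec] at hv
      rw [hv, Matrix.mulVec_zero]
    | succ m ih =>
      intro v hv
      rw [pow_succ, ← Matrix.mulVec_mulVec] at hv
      exact hM v (ih _ hv)
  set B := Polynomial.aeval M q with hB
  have hMB : M * B = 0 := by
    refine Matrix.toLin'.injective (LinearMap.ext fun v => ?_)
    have : (M ^ (M.charpoly.rootMultiplicity 0)).mulVec (B.mulVec v) = 0 := by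
      rw [Matrix.mulVec_mulVec, hch, Matrix.zero_mulVec]
    simpa [Matrix.toLin'_apply, ← Matrix.mulVec_mulVec] using hpow _ _ this
  have hBM : B * M = 0 := by
    rw [← hMB, show B * M = Polynomial.aeval M (q * Polynomial.X) by simp [hB],
      show M * B = Polynomial.aeval M (Polynomial.X * q) by simp [hB], mul_comm]
  -- `q` agrees with its constant coefficient up to a multiple of `X`
  obtain ⟨G, hG⟩ : ∃ G, B = G * M + q.eval 0 • 1 := by
    obtain ⟨g, hg⟩ : Polynomial.X ∣ q - Polynomial.C (q.eval 0) := by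
      rw [Polynomial.X_dvd_iff]; simp [Polynomial.coeff_zero_eq_eval_zero]
    refine ⟨Polynomial.aeval M g, ?_⟩
    have := congrArg (Polynomial.aeval M) hg
    rwa [map_sub, mul_comm, map_mul, Polynomial.aeval_X, Polynomial.aeval_C, sub_eq_iff_eq_add,
      Algebra.algebraMap_eq_smul_one] at this
  have hBB : B * B = q.eval 0 • B := by
    calc B * B = (G * M + q.eval 0 • 1) * B := by rw [← hG]
      _ = q.eval 0 • B := by rw [add_mul, mul_assoc, hMB]; simp
  have hEE : ((q.eval 0)⁻¹ • B) * ((q.eval 0)⁻¹ • B) = (q.eval 0)⁻¹ • B := by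
    rw [smul_mul_smul_comm, hBB, smul_smul]
    congr 1
    field_simp
  have hEM : ((q.eval 0)⁻¹ • B) * M = 0 := by simp [hBM]
  refine ⟨(q.eval 0)⁻¹ • B, hEE, hEM, ?_⟩
  intro hdet
  obtain ⟨v, hv, hv0⟩ := Matrix.exists_mulVec_eq_zero_iff.2 hdet
  set E := (q.eval 0)⁻¹ • B with hE
  have hEv : E.mulVec v = 0 := by
    have := congrArg E.mulVec hv0
    rwa [Matrix.mulVec_mulVec, mul_sub, hEE, hEM, sub_zero, Matrix.mulVec_zero] at this
  have hMv : M.mulVec v = 0 := by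
    rw [Matrix.sub_mulVec, hEv, zero_sub, neg_eq_zero] at hv0
    exact hv0
  have hBv : B.mulVec v = 0 := by
    rw [hE, Matrix.smul_mulVec] at hEv
    exact (smul_eq_zero.1 hEv).resolve_left (inv_ne_zero hq0)
  rw [hG, Matrix.add_mulVec, ← Matrix.mulVec_mulVec, hMv, Matrix.mulVec_zero, zero_add,
    Matrix.smul_mulVec, Matrix.one_mulVec] at hBv
  exact hv ((smul_eq_zero.1 hBv).resolve_left hq0)

/-- A matrix pencil `v E + B` that is regular for one `v` is singular for finitely many `v` only,
and some circle of radius below a prescribed bound avoids them all. -/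
theorem exists_radius_det_ne_zero (E B : Matrix (Fin N) (Fin N) ℂ)
    (h : ∃ v : ℂ, (v • E + B).det ≠ 0) {c : ℝ} (hc : 0 < c) :
    ∃ r : ℝ, 0 < r ∧ r < c ∧ ∀ v ∈ Metric.sphere (0 : ℂ) r, (v • E + B).det ≠ 0 := by
  set p : Polynomial ℂ := ((Polynomial.X : Polynomial ℂ) • E.map Polynomial.C +
    B.map Polynomial.C).det with hp
  have heval : ∀ v : ℂ, p.eval v = (v • E + B).det := by
    intro v
    rw [hp, ← Polynomial.coe_evalRingHom, RingHom.map_det]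
    congr 1
    ext a b
    simp [mul_comm v]
  have hp0 : p ≠ 0 := by
    rintro h0
    obtain ⟨v, hv⟩ := h
    rw [← heval, h0] at hv
    simp at hv
  obtain ⟨r, hr, hrn⟩ := (Set.Ioo_infinite hc).exists_notMem_finset
    (p.roots.toFinset.image fun v => ‖v‖)
  refine ⟨r, hr.1, hr.2, fun v hv hdet => hrn (Finset.mem_image.2 ⟨v, ?_, by simpa using hv⟩)⟩
  rw [Multiset.mem_toFinset, Polynomial.mem_roots hp0, Polynomial.IsRoot, heval, hdet]

/-- With `M = M₀ + t M₁`, the factor `t` is split off on the range of `E`: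
`t v - M = (t E + (1 - E)) * K`, where `K = v E - E M₁ + (1 - E) (t v - M)` no longer degenerates
as `t → 0`, and `t (t E + (1 - E))⁻¹ = E + t (1 - E)`. -/
theorem smul_inv_eq_of_reduction {E M₀ M₁ : Matrix (Fin N) (Fin N) ℂ} (hE : E * E = E)
    (hEM : E * M₀ = 0) {t : ℂ} (ht : t ≠ 0) (v : ℂ) :
    t • ((t * v) • (1 : Matrix (Fin N) (Fin N) ℂ) - (M₀ + t • M₁))⁻¹ =
      (v • E - E * M₁ + (1 - E) * ((t * v) • (1 : Matrix (Fin N) (Fin N) ℂ) - (M₀ + t • M₁)))⁻¹ *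
        (E + t • (1 - E)) := by
  have hL : (t • E + (1 - E))⁻¹ = t⁻¹ • E + (1 - E) := by
    refine Matrix.inv_eq_right_inv ?_
    simp only [add_mul, mul_add, mul_sub, sub_mul, smul_mul_assoc, mul_smul_comm, hE, mul_one,
      one_mul]
    match_scalars <;> field_simp
    ring
  have hfac : (t • E + (1 - E)) *
      (v • E - E * M₁ + (1 - E) * ((t * v) • (1 : Matrix (Fin N) (Fin N) ℂ) - (M₀ + t • M₁))) =
      (t * v) • (1 : Matrix (Fin N) (Fin N) ℂ) - (M₀ + t • M₁) := by
    have h1 : ∀ Z : Matrix (Fin N) (Fin N) ℂ, E * (E * Z) = E * Z := fun Z => by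
      rw [← mul_assoc, hE]
    simp only [add_mul, mul_add, mul_sub, sub_mul, smul_mul_assoc, mul_smul_comm, hE, mul_one,
      one_mul, h1, hEM, mul_zero]
    module
  rw [← hfac, Matrix.mul_inv_rev, hL, hfac, ← Matrix.mul_smul, smul_add, smul_smul,
    mul_inv_cancel₀ ht, one_smul]

/-- An analytic family `T` whose value at `0` has the semisimple eigenvalue `μ`, and whose
eigenvalues other than `μ` stay at distance at least `c * ‖t‖` from `μ`, has a Riesz projection at
`μ` that is analytic up to `t = 0`. On the circle `w = μ + t v`, `‖v‖ = r`, the factorization of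
`smul_inv_eq_of_reduction` turns the integrand into one that is analytic in `t` up to `t = 0`. -/
theorem rieszProjectionExtends_of_gap {T : ℂ → Matrix (Fin N) (Fin N) ℂ} {μ : ℂ}
    (hT : ∀ a b, AnalyticAt ℂ (fun t => T t a b) 0)
    (hss : ∀ v, (T 0 - μ • 1).mulVec ((T 0 - μ • 1).mulVec v) = 0 →
      (T 0 - μ • 1).mulVec v = 0)
    {c : ℝ} (hc : 0 < c)
    (hgap : ∀ᶠ t in 𝓝[≠] (0 : ℂ), ∀ w ∈ spectrum ℂ (T t), w ≠ μ → c * ‖t‖ ≤ ‖w - μ‖) :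
    RieszProjectionExtends T μ := by
  set M₀ : Matrix (Fin N) (Fin N) ℂ := T 0 - μ • 1 with hM₀
  obtain ⟨E, hE, hEM, hdet⟩ := exists_kernel_idempotent M₀ hss
  set M₁ : ℂ → Matrix (Fin N) (Fin N) ℂ := fun t =>
    Matrix.of fun a b => dslope (fun s => T s a b) 0 t with hM₁
  have hM₁an : ∀ a b, AnalyticAt ℂ (fun t => M₁ t a b) 0 := by
    intro a b
    obtain ⟨p, hp⟩ := hT a b
    exact hp.has_fpower_series_dslope_fslope.analyticAt
  have hTM : ∀ t, T t - μ • 1 = M₀ + t • M₁ t := by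
    intro t
    ext a b
    have := sub_smul_dslope (fun s => T s a b) 0 t
    simp only [sub_zero, smul_eq_mul] at this
    simp only [hM₀, hM₁, Matrix.sub_apply, Matrix.add_apply, Matrix.smul_apply, Matrix.of_apply,
      smul_eq_mul, this]
    ring
  set K : ℂ × ℂ → Matrix (Fin N) (Fin N) ℂ := fun x => x.2 • E - E * M₁ x.1 +
    (1 - E) * ((x.1 * x.2) • (1 : Matrix (Fin N) (Fin N) ℂ) - (M₀ + x.1 • M₁ x.1)) with hK
  have hK0 : ∀ v, K (0, v) = v • E + -(E * M₁ 0 + M₀) := by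
    intro v
    simp only [hK, zero_mul, zero_smul, add_zero, zero_sub, mul_neg, sub_mul, one_mul, hEM]
    abel
  -- `det (v E - (E M₁(0) + M₀))` is not identically zero, by its behaviour as `v → ∞`
  have hex : ∃ v : ℂ, (v • E + -(E * M₁ 0 + M₀)).det ≠ 0 := by
    have hcont : ContinuousAt (fun s : ℂ => (E - s • (E * M₁ 0) - M₀).det) 0 := by
      have : Continuous fun s : ℂ => E - s • (E * M₁ 0) - M₀ := by fun_prop
      exact this.matrix_det.continuousAt
    have hev := (hcont.eventually_ne (y := 0) (by simpa using hdet))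
    obtain ⟨s, hs, hs0⟩ := ((hev.filter_mono nhdsWithin_le_nhds).and
      (self_mem_nhdsWithin : {(0 : ℂ)}ᶜ ∈ 𝓝[≠] (0 : ℂ))).exists
    have hs0 : s ≠ 0 := hs0
    refine ⟨s⁻¹, fun h0 => hs ?_⟩
    have : E - s • (E * M₁ 0) - M₀ =
        (s • E + (1 - E)) * (s⁻¹ • E + -(E * M₁ 0 + M₀)) := by
      have h1 : ∀ Z : Matrix (Fin N) (Fin N) ℂ, E * (E * Z) = E * Z := fun Z => by
        rw [← mul_assoc, hE]
      simp only [add_mul, mul_add, mul_neg, neg_add, sub_mul, smul_mul_assoc, mul_smul_comm, hE,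
        one_mul, h1, hEM]
      match_scalars <;> field_simp <;> ring
    rw [this, Matrix.det_mul, h0, mul_zero]
  obtain ⟨r, hr, hrc, hrdet⟩ := exists_radius_det_ne_zero E _ hex hc
  have hKan : ∀ v, ∀ a b, AnalyticAt ℂ (fun x => K x a b) (0, v) := by
    intro v a b
    have hfst : AnalyticAt ℂ (fun x : ℂ × ℂ => x.1) (0, v) := analyticAt_fst
    have hsnd : AnalyticAt ℂ (fun x : ℂ × ℂ => x.2) (0, v) := analyticAt_snd
    have h1 : ∀ a b, AnalyticAt ℂ (fun x : ℂ × ℂ => M₁ x.1 a b) (0, v) := fun a b =>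
      AnalyticAt.comp (g := fun t => M₁ t a b) (f := fun x : ℂ × ℂ => x.1) (hM₁an a b) hfst
    refine ((hsnd.mul analyticAt_const).sub ?_).add ?_
    · exact analyticAt_mul_apply (M := fun _ => E) (M' := fun x : ℂ × ℂ => M₁ x.1)
        (fun _ _ => analyticAt_const) h1 a b
    · refine analyticAt_mul_apply (M := fun _ => 1 - E) (M' := fun x : ℂ × ℂ =>
        (x.1 * x.2) • (1 : Matrix (Fin N) (Fin N) ℂ) - (M₀ + x.1 • M₁ x.1))
        (fun _ _ => analyticAt_const) (fun a b => ?_) a b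
      exact ((hfst.mul hsnd).mul analyticAt_const).sub (analyticAt_const.add (hfst.mul (h1 a b)))
  set Q : ℂ → Matrix (Fin N) (Fin N) ℂ := fun t => Matrix.of fun a b =>
    (2 * Real.pi * Complex.I)⁻¹ *
      ∮ v in C(0, r), ((K (t, v))⁻¹ * (E + t • (1 - E))) a b with hQ
  have hQan : ∀ a b, AnalyticAt ℂ (fun t => Q t a b) 0 := by
    intro a b
    refine analyticAt_const.mul (analyticAt_circleIntegral
      (g := fun x => ((K x)⁻¹ * (E + x.1 • (1 - E))) a b) hr.le fun v hv => ?_)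
    refine analyticAt_mul_apply (M := fun x => (K x)⁻¹) (M' := fun x : ℂ × ℂ => E + x.1 • (1 - E))
      (fun a b => analyticAt_inv_apply (hKan v) (by rw [hK0]; exact hrdet v hv) a b)
      (fun a b => ?_) a b
    exact analyticAt_const.add (analyticAt_fst.mul analyticAt_const)
  -- the circle of radius `r * ‖t‖` is isolating and yields `Q t`
  have hiso : ∀ᶠ t in 𝓝[≠] (0 : ℂ), IsIsolatingRadius (T t) μ (r * ‖t‖) ∧
      rieszProjection (T t) μ (r * ‖t‖) = Q t := by
    filter_upwards [hgap, self_mem_nhdsWithin] with t ht ht0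
    have ht0 : t ≠ 0 := ht0
    have htn : 0 < ‖t‖ := norm_pos_iff.2 ht0
    refine ⟨⟨by positivity, fun w hw hne => ?_⟩, ?_⟩
    · rw [dist_eq_norm]
      exact (mul_lt_mul_of_pos_right hrc htn).trans_le (ht w hw hne)
    · ext a b
      simp only [rieszProjection, hQ, Matrix.of_apply]
      rw [circleIntegral_comp_add_mul]
      congr 1
      refine circleIntegral.integral_congr hr.le fun v _ => ?_
      have := smul_inv_eq_of_reduction hE hEM ht0 v (M₁ := M₁ t)
      have e : (μ + t * v) • (1 : Matrix (Fin N) (Fin N) ℂ) - T t =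
          (t * v) • 1 - (M₀ + t • M₁ t) := by
        rw [← hTM]; module
      simp only [hK, e]
      rw [← this, Matrix.smul_apply, smul_eq_mul]
  refine ⟨Q, hQan, ?_, ?_⟩
  · filter_upwards [hiso] with t ht δ hδ
    rw [← ht.2]
    exact rieszProjection_eq hδ ht.1
  · have hQc : ContinuousAt Q 0 :=
      continuousAt_pi.2 fun a => continuousAt_pi.2 fun b => (hQan a b).continuousAt
    have h1 : Tendsto (fun t => Q t * Q t) (𝓝[≠] 0) (𝓝 (Q 0 * Q 0)) :=
      (hQc.mul hQc).tendsto.mono_left nhdsWithin_le_nhds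
    have h2 : Tendsto (fun t => Q t * Q t) (𝓝[≠] 0) (𝓝 (Q 0)) := by
      refine (hQc.tendsto.mono_left nhdsWithin_le_nhds).congr' ?_
      filter_upwards [hiso] with t ht
      rw [← ht.2]
      exact (isIdempotentElem_rieszProjection ht.1).symm
    exact tendsto_nhds_unique h1 h2

end

section

/-! ### Semisimplicity of the eigenvalues of normal and diagonalizable matrices -/

open ComplexOrder in
/-- The kernel of a normal matrix is also the kernel of its adjoint, hence orthogonal to the
range. -/
theorem mulVec_eq_zero_of_isStarNormal {N : ℕ} {M : Matrix (Fin N) (Fin N) ℂ} (hM : IsStarNormal M)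
    {v : Fin N → ℂ} (hv : M.mulVec (M.mulVec v) = 0) : M.mulVec v = 0 := by
  have hcomm : M.conjTranspose * M = M * M.conjTranspose := hM.star_comm_self
  have h1 : (M.conjTranspose * M).mulVec (M.mulVec v) = 0 :=
    (Matrix.conjTranspose_mul_self_mulVec_eq_zero M _).2 hv
  rw [hcomm, Matrix.self_mul_conjTranspose_mulVec_eq_zero, Matrix.mulVec_mulVec] at h1
  exact (Matrix.conjTranspose_mul_self_mulVec_eq_zero M v).1 h1

theorem mulVec_eq_zero_of_isDiagonalizable {N : ℕ} {M : Matrix (Fin N) (Fin N) ℂ}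
    (hM : IsDiagonalizable M) {v : Fin N → ℂ} (hv : M.mulVec (M.mulVec v) = 0) :
    M.mulVec v = 0 := by
  obtain ⟨S, a, hS, rfl⟩ := hM
  have hinv := Matrix.nonsing_inv_mul S hS
  have h1 : (Matrix.diagonal a * Matrix.diagonal a).mulVec (S⁻¹.mulVec v) = 0 := by
    have := congrArg S⁻¹.mulVec hv
    rw [Matrix.mulVec_mulVec, Matrix.mulVec_mulVec, Matrix.mulVec_zero] at this
    rw [Matrix.mulVec_mulVec, ← this]
    congr 1
    calc Matrix.diagonal a * Matrix.diagonal a * S⁻¹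
        = (S⁻¹ * S) * Matrix.diagonal a * (S⁻¹ * S) * Matrix.diagonal a * S⁻¹ := by simp [hinv]
      _ = _ := by simp only [mul_assoc]
  have h2 : (Matrix.diagonal a).mulVec (S⁻¹.mulVec v) = 0 := by
    ext i
    have := congrFun h1 i
    rw [Matrix.diagonal_mul_diagonal, Matrix.mulVec_diagonal] at this
    rw [Matrix.mulVec_diagonal]
    simpa using this
  rw [mul_assoc, ← Matrix.mulVec_mulVec, ← Matrix.mulVec_mulVec, h2, Matrix.mulVec_zero]

theorem mulVec_eq_zero_of_semisimple {N : ℕ} {M : Matrix (Fin N) (Fin N) ℂ}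
    (hM : IsStarNormal M ∨ IsDiagonalizable M) (μ : ℂ) {v : Fin N → ℂ}
    (hv : (M - μ • 1).mulVec ((M - μ • 1).mulVec v) = 0) : (M - μ • 1).mulVec v = 0 := by
  rcases hM with hM | ⟨S, a, hS, rfl⟩
  · refine mulVec_eq_zero_of_isStarNormal ⟨?_⟩ hv
    have h1 : Commute (star M) M := hM.star_comm_self
    rw [star_sub, star_smul, star_one]
    exact (h1.sub_left ((Commute.one_left M).smul_left _)).sub_right
      ((Commute.one_right _).smul_right _)
  · refine mulVec_eq_zero_of_isDiagonalizable ⟨S, fun i => a i - μ, hS, ?_⟩ hv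
    have : Matrix.diagonal (fun i => a i - μ) = Matrix.diagonal a - μ • 1 := by
      ext i j
      by_cases h : i = j <;> simp [h]
    rw [this, mul_sub, sub_mul, mul_smul_comm, smul_mul_assoc, mul_one, Matrix.mul_nonsing_inv S hS]

/-! ### Polynomial hypersurfaces near a point -/

variable {k s : ℕ}

/-- The differential of the polynomial `f` at `p`. -/
def gradCLM (f : MvPolynomial (Fin (k + 1)) ℂ) (p : Fin (k + 1) → ℂ) :
    (Fin (k + 1) → ℂ) →L[ℂ] ℂ :=
  ∑ i, gradAt f p i • ContinuousLinearMap.proj i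

theorem gradCLM_apply (f : MvPolynomial (Fin (k + 1)) ℂ) (p u : Fin (k + 1) → ℂ) :
    gradCLM f p u = ∑ i, gradAt f p i * u i := by
  simp [gradCLM]

theorem hasStrictFDerivAt_eval (f : MvPolynomial (Fin (k + 1)) ℂ) (p : Fin (k + 1) → ℂ) :
    HasStrictFDerivAt (fun x => eval x f) (gradCLM f p) p := by
  induction f using MvPolynomial.induction_on with
  | C a =>
    simp only [eval_C]
    refine (hasStrictFDerivAt_const a p).congr_fderiv (ContinuousLinearMap.ext fun u => ?_)
    simp [gradCLM_apply, gradAt]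
  | add f g hf hg =>
    simp only [map_add]
    refine (hf.add hg).congr_fderiv (ContinuousLinearMap.ext fun u => ?_)
    simp [gradCLM_apply, gradAt, add_mul, Finset.sum_add_distrib]
  | mul_X f i hf =>
    simp only [map_mul, eval_X]
    refine (hf.mul (ContinuousLinearMap.proj (R := ℂ) (φ := fun _ : Fin (k + 1) => ℂ)
      i).hasStrictFDerivAt).congr_fderiv (ContinuousLinearMap.ext fun u => ?_)
    simp only [gradCLM_apply, gradAt, Derivation.leibniz, pderiv_X, smul_eq_mul, map_add, map_mul,
      eval_X, add_mul, Finset.sum_add_distrib, add_apply, smul_apply,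
      ContinuousLinearMap.proj_apply, Finset.mul_sum]
    congr 1
    · rw [Finset.sum_eq_single i]
      · simp
      · intro b _ hb
        simp [hb.symm]
      · simp
    · exact Finset.sum_congr rfl fun b _ => by ring

theorem gradCLM_point_zero (f : MvPolynomial (Fin (k + 1)) ℂ) (p : Fin (k + 1) → ℂ)
    (d : Fin (k + 1)) (z : ℂ) : gradCLM f p (point d z 0) = z * eval p (pderiv d f) := by
  rw [gradCLM_apply, Fin.sum_univ_succAbove _ d]
  simp [point, gradAt, mul_comm]

theorem proj_point (d : Fin (k + 1)) (z : ℂ) (v : Fin k → ℂ) : proj d (point d z v) = v := by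
  ext i; simp [proj, point, Fin.removeNth]

/-- `proj d` as a continuous linear map. -/
def projCLM (d : Fin (k + 1)) : (Fin (k + 1) → ℂ) →L[ℂ] (Fin k → ℂ) :=
  ContinuousLinearMap.pi fun i => ContinuousLinearMap.proj (d.succAbove i)

theorem analyticAt_point {E : Type*} [NormedAddCommGroup E] [NormedSpace ℂ E] (d : Fin (k + 1))
    {z : E → ℂ} {v : E → Fin k → ℂ} {x : E} (hz : AnalyticAt ℂ z x) (hv : AnalyticAt ℂ v x) :
    AnalyticAt ℂ (fun y => point d (z y) (v y)) x := by
  rw [analyticAt_pi_iff]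
  intro i
  refine Fin.succAboveCases d ?_ (fun l => ?_) i
  · simpa [point] using hz
  · simpa [point] using (analyticAt_pi_iff.1 hv) l

theorem mem_singularLocus_of_two {f : Fin s → MvPolynomial (Fin (k + 1)) ℂ}
    {p x : Fin (k + 1) → ℂ} {i j : Fin s} (hij : i ≠ j) (hi : eval p (f i) = 0)
    (hj : eval p (f j) = 0) (hxi : eval x (f i) = 0) (hxj : eval x (f j) = 0) :
    x ∈ singularLocus (localEquation f p) := by
  classical
  obtain ⟨h, hh⟩ : ∃ h, localEquation f p = f i * (f j * h) := by
    have h1 : i ∈ Finset.univ.filter (fun j => eval p (f j) = 0) := by simpa using hi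
    have h2 : j ∈ (Finset.univ.filter (fun j => eval p (f j) = 0)).erase i := by
      simp [hj, hij.symm]
    refine ⟨∏ l ∈ ((Finset.univ.filter (fun j => eval p (f j) = 0)).erase i).erase j, f l, ?_⟩
    rw [Finset.mul_prod_erase _ _ h2, Finset.mul_prod_erase _ _ h1, localEquation]
  refine ⟨by rw [hh]; simp [hxi], ?_⟩
  ext l
  simp [gradAt, hh, Derivation.leibniz, hxi, hxj]

/-- If two components of the hypersurface meet transversally at `p`, the projection of every
vector tangent to both of them is tangent to the projected singular locus: the two components
intersect in a manifold whose tangent space is the common kernel of the two differentials. -/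
theorem isTangentDirection_of_gradCLM_eq_zero {d : Fin (k + 1)}
    {f : Fin s → MvPolynomial (Fin (k + 1)) ℂ} {p : Fin (k + 1) → ℂ} (hp : proj d p = 0)
    {i j : Fin s} (hij : i ≠ j) (hi : eval p (f i) = 0) (hj : eval p (f j) = 0)
    (hlin : LinearIndependent ℂ ![gradAt (f i) p, gradAt (f j) p]) {u : Fin (k + 1) → ℂ}
    (hui : gradCLM (f i) p u = 0) (huj : gradCLM (f j) p u = 0) :
    IsTangentDirection d f p (proj d u) := by
  intro O hO
  set G : (Fin (k + 1) → ℂ) → ℂ × ℂ := fun x => (eval x (f i), eval x (f j)) with hG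
  set G' := (gradCLM (f i) p).prod (gradCLM (f j) p) with hG'
  have hGs : HasStrictFDerivAt G G' p :=
    (hasStrictFDerivAt_eval (f i) p).prodMk (hasStrictFDerivAt_eval (f j) p)
  have hrange : G'.range = ⊤ := by
    by_contra hne
    obtain ⟨l, hl, hle⟩ := Submodule.exists_le_ker_of_lt_top _ (lt_top_iff_ne_top.2 hne)
    have hl' : ∀ a b : ℂ, l (a, b) = a * l (1, 0) + b * l (0, 1) := by
      intro a b
      have : ((a, b) : ℂ × ℂ) = a • (1, 0) + b • (0, 1) := by simp
      rw [this, map_add, map_smul, map_smul, smul_eq_mul, smul_eq_mul]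
    have hcomb : l (1, 0) • gradAt (f i) p + l (0, 1) • gradAt (f j) p = 0 := by
      ext m
      have h1 : l (G' (Pi.single m 1)) = 0 := hle ⟨Pi.single m 1, rfl⟩
      have h2 : ∀ g : MvPolynomial (Fin (k + 1)) ℂ,
          gradCLM g p (Pi.single m 1) = gradAt g p m := fun g => by
        simp [gradCLM_apply, Pi.single_apply]
      rw [hG', ContinuousLinearMap.prod_apply, h2, h2, hl'] at h1
      simp only [Pi.add_apply, Pi.smul_apply, smul_eq_mul, Pi.zero_apply]
      linear_combination h1
    obtain ⟨h1, h2⟩ := LinearIndependent.pair_iff.1 hlin _ _ hcomb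
    refine hl (LinearMap.ext fun x => ?_)
    rw [← Prod.mk.eta (p := x), hl', h1, h2]
    simp
  have huker : u ∈ G'.ker := by
    simp [hG', LinearMap.mem_ker, hui, huj]
  set γ : ℂ → (Fin (k + 1) → ℂ) := fun t =>
    hGs.implicitFunction G G' hrange (G p) (t • ⟨u, huker⟩) with hγ
  have hγ0 : γ 0 = p := by
    simp only [hγ, zero_smul, HasStrictFDerivAt.implicitFunction_apply_image]
  have hγd : HasDerivAt γ u 0 := by
    have h1 := (hGs.to_implicitFunction hrange).hasFDerivAt
    have h2 : HasDerivAt (fun t : ℂ => t • (⟨u, huker⟩ : G'.ker)) ⟨u, huker⟩ 0 := by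
      simpa using (hasDerivAt_id (0 : ℂ)).smul_const (⟨u, huker⟩ : G'.ker)
    have h3 : HasFDerivAt (hGs.implicitFunction G G' hrange (G p)) G'.ker.subtypeL
        ((fun t : ℂ => t • (⟨u, huker⟩ : G'.ker)) 0) := by simpa using h1
    exact h3.comp_hasDerivAt 0 h2
  have hγc : Tendsto γ (𝓝 0) (𝓝 p) := by
    have := hγd.continuousAt.tendsto
    rwa [hγ0] at this
  have hmem : ∀ᶠ t in 𝓝 (0 : ℂ), G (γ t) = G p := by
    have h1 := hGs.map_implicitFunction_eq hrange
    have h2 : Tendsto (fun t : ℂ => (G p, t • (⟨u, huker⟩ : G'.ker))) (𝓝 0) (𝓝 (G p, 0)) := by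
      have : Continuous fun t : ℂ => (G p, t • (⟨u, huker⟩ : G'.ker)) := by fun_prop
      simpa using this.tendsto 0
    exact h2.eventually h1
  have hpd : HasDerivAt (fun t => proj d (γ t)) (proj d u) 0 :=
    (projCLM d).hasFDerivAt.comp_hasDerivAt 0 hγd
  have hp0 : proj d (γ 0) = 0 := by rw [hγ0, hp]
  refine mem_tangentConeAt_of_seq (𝓝[≠] (0 : ℂ)) (fun t => t⁻¹) (fun t => proj d (γ t)) ?_ ?_ ?_
  · have := hpd.continuousAt.tendsto
    rw [hp0] at this
    exact this.mono_left nhdsWithin_le_nhds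
  · filter_upwards [nhdsWithin_le_nhds hmem, nhdsWithin_le_nhds (hγc.eventually hO)] with t ht htO
    rw [zero_add]
    simp only [hG, hi, hj, Prod.mk.injEq] at ht
    exact ⟨γ t, ⟨mem_singularLocus_of_two hij hi hj ht.1 ht.2, htO⟩, rfl⟩
  · have := hpd.tendsto_slope_zero
    simpa [hp0] using this

/-- A curve through `p` lying over a line that is not tangent to the projected singular locus
meets the singular locus at most at `p`, locally. -/
theorem eventually_notMem_singularLocus {d : Fin (k + 1)}
    {f : Fin s → MvPolynomial (Fin (k + 1)) ℂ} {p : Fin (k + 1) → ℂ} {v : Fin k → ℂ}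
    (hv : ¬ IsTangentDirection d f p v) {q : ℂ → Fin (k + 1) → ℂ} (hq : Tendsto q (𝓝 0) (𝓝 p))
    (hqv : ∀ t, proj d (q t) = t • v) :
    ∀ᶠ t in 𝓝[≠] (0 : ℂ), q t ∉ singularLocus (localEquation f p) := by
  by_contra hcon
  refine hv fun O hO => ?_
  have hfreq : ∃ᶠ t in 𝓝[≠] (0 : ℂ), q t ∈ singularLocus (localEquation f p) := by
    simpa [Filter.not_eventually] using hcon
  refine mem_tangentConeAt_of_frequently (𝓝[≠] (0 : ℂ)) (fun t => t⁻¹) (fun t => t • v) ?_ ?_ ?_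
  · have : Continuous fun t : ℂ => t • v := by fun_prop
    have := this.tendsto 0
    rw [zero_smul] at this
    exact this.mono_left nhdsWithin_le_nhds
  · refine (hfreq.and_eventually (nhdsWithin_le_nhds (hq.eventually hO))).mono fun t ht => ?_
    rw [zero_add, ← hqv]
    exact ⟨q t, ht, rfl⟩
  · refine tendsto_nhds_of_eventually_eq ?_
    filter_upwards [self_mem_nhdsWithin] with t ht
    have ht : t ≠ 0 := ht
    rw [smul_smul, inv_mul_cancel₀ ht, one_smul]

/-- The analytic implicit function theorem for `f = 0`. -/
theorem exists_isBranch {d : Fin (k + 1)} {f : MvPolynomial (Fin (k + 1)) ℂ} {z₀ : ℂ}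
    (hf : eval (point d z₀ 0) f = 0) (hd : eval (point d z₀ 0) (pderiv d f) ≠ 0) :
    ∃ φ, IsBranch d f z₀ φ := by
  set p := point d z₀ (0 : Fin k → ℂ) with hp
  set F : (Fin k → ℂ) × ℂ → ℂ := fun x => eval (point d x.2 x.1) f with hF
  have hpt : AnalyticAt ℂ (fun x : (Fin k → ℂ) × ℂ => point d x.2 x.1) (0, z₀) :=
    analyticAt_point d analyticAt_snd analyticAt_fst
  have hFan : AnalyticAt ℂ F (0, z₀) :=
    AnalyticAt.aeval_mvPolynomial (fun i => analyticAt_pi_iff.1 hpt i) f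
  have hFc : ContDiffAt ℂ ⊤ F (0, z₀) := hFan.contDiffAt
  have hFd : HasDerivAt (fun z => F (0, z)) (eval p (pderiv d f)) z₀ := by
    have h1 : HasDerivAt (fun z : ℂ => point d z (0 : Fin k → ℂ)) (point d 1 0) z₀ := by
      rw [hasDerivAt_pi]
      intro i
      refine Fin.succAboveCases d ?_ (fun l => ?_) i
      · simpa [point] using hasDerivAt_id' z₀
      · simpa [point] using hasDerivAt_const z₀ (0 : ℂ)
    have := (hasStrictFDerivAt_eval f p).hasFDerivAt.comp_hasDerivAt z₀ h1
    rwa [gradCLM_point_zero, one_mul] at this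
  have hinr : ∀ z, (fderiv ℂ F (0, z₀) ∘L .inr ℂ (Fin k → ℂ) ℂ) z = z * eval p (pderiv d f) := by
    intro z
    have h1 : HasDerivAt (fun z : ℂ => ((0 : Fin k → ℂ), z)) (0, 1) z₀ :=
      (hasDerivAt_const z₀ (0 : Fin k → ℂ)).prodMk (hasDerivAt_id z₀)
    have h2 := hFan.differentiableAt.hasFDerivAt.comp_hasDerivAt z₀ h1
    have h3 : fderiv ℂ F (0, z₀) (0, 1) = eval p (pderiv d f) := h2.unique hFd
    have h4 : ((0 : Fin k → ℂ), z) = z • ((0 : Fin k → ℂ), (1 : ℂ)) := by simp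
    rw [ContinuousLinearMap.comp_apply, ContinuousLinearMap.inr_apply, h4, map_smul, h3,
      smul_eq_mul]
  have hinv : (fderiv ℂ F (0, z₀) ∘L .inr ℂ (Fin k → ℂ) ℂ).IsInvertible := by
    refine ⟨ContinuousLinearEquiv.unitsEquivAut ℂ (Units.mk0 _ hd), ?_⟩
    ext
    simp [hinr]
  have hne : (⊤ : WithTop ℕ∞) ≠ 0 := by simp
  refine ⟨hFc.implicitFunction hne hinv, ?_, ?_, ?_⟩
  · exact (hFc.contDiffAt_implicitFunction hne hinv).analyticAt
  · exact hFc.implicitFunction_apply_self hne hinv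
  · have := hFc.eventually_apply_implicitFunction hne hinv
    simpa [hF, hp ▸ hf] using this

/-! ### Separation of the zeros -/

theorem clm_prod_apply (g' : ℂ × ℂ →L[ℂ] ℂ) (x : ℂ × ℂ) :
    g' x = x.1 * g' (1, 0) + x.2 * g' (0, 1) := by
  have : x = x.1 • ((1 : ℂ), (0 : ℂ)) + x.2 • ((0 : ℂ), (1 : ℂ)) := by ext <;> simp
  conv_lhs => rw [this]
  rw [map_add, map_smul, map_smul, smul_eq_mul, smul_eq_mul]

/-- If the derivative of `g(t, w)` in `t` does not vanish at the zero `(0, 0)`, the other zeros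
`w` of `g(t, ·)` are at least of order `t`. -/
theorem exists_gap_of_deriv_ne_zero {g : ℂ × ℂ → ℂ} {g' : ℂ × ℂ →L[ℂ] ℂ}
    (hg : HasStrictFDerivAt g g' 0) (h0 : g 0 = 0) (hα : g' (1, 0) ≠ 0) :
    ∃ c > 0, ∀ᶠ x in 𝓝 (0 : ℂ × ℂ), g x = 0 → c * ‖x.1‖ ≤ ‖x.2‖ := by
  have hα' : 0 < ‖g' (1, 0)‖ := norm_pos_iff.2 hα
  refine ⟨‖g' (1, 0)‖ / 2 / (‖g' (0, 1)‖ + ‖g' (1, 0)‖ / 2), by positivity, ?_⟩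
  filter_upwards [hg.hasFDerivAt.isLittleO.def (half_pos hα')] with x hx hx0
  rw [hx0, h0, sub_zero, zero_sub, norm_neg, clm_prod_apply] at hx
  have h1 : ‖x.1‖ * ‖g' (1, 0)‖ - ‖x.2‖ * ‖g' (0, 1)‖ ≤
      ‖x.1 * g' (1, 0) + x.2 * g' (0, 1)‖ := by
    have := norm_sub_le (x.1 * g' (1, 0) + x.2 * g' (0, 1)) (x.2 * g' (0, 1))
    rw [add_sub_cancel_right, norm_mul, norm_mul] at this
    linarith
  have h2 : ‖x‖ ≤ ‖x.1‖ + ‖x.2‖ := by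
    rw [Prod.norm_def]
    exact max_le (by linarith [norm_nonneg x.2]) (by linarith [norm_nonneg x.1])
  rw [sub_zero] at hx
  have h3 := h1.trans (hx.trans (mul_le_mul_of_nonneg_left h2 (half_pos hα').le))
  rw [div_mul_eq_mul_div, div_le_iff₀ (by positivity)]
  linarith

/-- If `g(t, 0) = 0` and the derivative of `g(t, w)` in `w` does not vanish at `(0, 0)`, then `0`
is locally the only zero of `g(t, ·)`. -/
theorem eventually_eq_zero_of_deriv_ne_zero {g : ℂ × ℂ → ℂ} {g' : ℂ × ℂ →L[ℂ] ℂ}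
    (hg : HasStrictFDerivAt g g' 0) (h0 : ∀ᶠ t in 𝓝 (0 : ℂ), g (t, 0) = 0)
    (hβ : g' (0, 1) ≠ 0) : ∀ᶠ x in 𝓝 (0 : ℂ × ℂ), g x = 0 → x.2 = 0 := by
  have hβ' : 0 < ‖g' (0, 1)‖ := norm_pos_iff.2 hβ
  have ht : Tendsto (fun x : ℂ × ℂ => (x, (x.1, (0 : ℂ)))) (𝓝 0) (𝓝 (0, 0)) := by
    have : Continuous fun x : ℂ × ℂ => (x, (x.1, (0 : ℂ))) := by fun_prop
    exact this.tendsto 0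
  have h1 : ∀ᶠ x : ℂ × ℂ in 𝓝 0, g (x.1, 0) = 0 := continuous_fst.tendsto (0 : ℂ × ℂ) h0
  filter_upwards [ht.eventually (hg.isLittleO.def (half_pos hβ')), h1] with x hx hx1 hx0
  have e : x - (x.1, 0) = (0, x.2) := by ext <;> simp
  rw [hx0, hx1, e, sub_zero, zero_sub, norm_neg, clm_prod_apply, zero_mul, zero_add, norm_mul,
    Prod.norm_def] at hx
  simp only [norm_zero, norm_nonneg, sup_of_le_right] at hx
  by_contra hne
  nlinarith [norm_pos_iff.2 hne]

/-- Let `q(t) = b(t, 0)` be a curve in the component `{f j = 0}`, over a line that is not tangent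
to the projected singular locus, and let `b(0, ·)` be transversal to that component. Then every
`w ≠ 0` such that `b(t, w)` lies on the hypersurface is at least of order `t`. -/
theorem exists_gap {d : Fin (k + 1)} {f : Fin s → MvPolynomial (Fin (k + 1)) ℂ}
    {p : Fin (k + 1) → ℂ} (hreg : Regularity d f p) (hp : proj d p = 0) {v : Fin k → ℂ}
    (hv : ¬ IsTangentDirection d f p v) {j : Fin s} (hj : eval p (f j) = 0)
    {b : ℂ × ℂ → Fin (k + 1) → ℂ} (hb : AnalyticAt ℂ b 0) (hb0 : b 0 = p)
    (hbv : ∀ t, proj d (b (t, 0)) = t • v)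
    (hbj : ∀ᶠ t in 𝓝 (0 : ℂ), eval (b (t, 0)) (f j) = 0)
    {e : Fin (k + 1) → ℂ} (hbe : HasDerivAt (fun w => b (0, w)) e 0)
    (he : gradCLM (f j) p e ≠ 0) :
    ∃ c > 0, ∀ᶠ x in 𝓝 (0 : ℂ × ℂ),
      (∃ i, eval (b x) (f i) = 0) → x.2 ≠ 0 → c * ‖x.1‖ ≤ ‖x.2‖ := by
  set u : Fin (k + 1) → ℂ := fderiv ℂ b 0 (1, 0) with hu
  have hbd := hb.differentiableAt.hasFDerivAt
  have hfst : HasDerivAt (fun t : ℂ => (t, (0 : ℂ))) (1, 0) 0 :=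
    (hasDerivAt_id' 0).prodMk (hasDerivAt_const 0 0)
  have hsnd : HasDerivAt (fun w : ℂ => ((0 : ℂ), w)) (0, 1) 0 :=
    (hasDerivAt_const 0 0).prodMk (hasDerivAt_id' 0)
  have hbt : HasDerivAt (fun t => b (t, 0)) u 0 :=
    HasFDerivAt.comp_hasDerivAt (f := fun t : ℂ => (t, (0 : ℂ))) 0 hbd hfst
  have hbw : fderiv ℂ b 0 (0, 1) = e :=
    (HasFDerivAt.comp_hasDerivAt (f := fun w : ℂ => ((0 : ℂ), w)) 0 hbd hsnd).unique hbe
  have huv : proj d u = v := by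
    have h1 : HasDerivAt (fun t => proj d (b (t, 0))) (proj d u) 0 :=
      (projCLM d).hasFDerivAt.comp_hasDerivAt 0 hbt
    simp only [hbv] at h1
    have h2 : HasDerivAt (fun t : ℂ => t • v) v 0 := by
      simpa using (hasDerivAt_id' (0 : ℂ)).smul_const v
    exact h1.unique h2
  -- the equations of the components along `b`, and their derivatives
  have hg : ∀ i, HasStrictFDerivAt (fun x => eval (b x) (f i))
      ((gradCLM (f i) p).comp (fderiv ℂ b 0)) 0 := by
    intro i
    rw [← hb0]
    exact (hasStrictFDerivAt_eval (f i) (b 0)).comp 0 hb.hasStrictFDerivAt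
  have huj : gradCLM (f j) p u = 0 := by
    have h1 : HasDerivAt (fun t => eval (b (t, 0)) (f j)) (gradCLM (f j) p u) 0 :=
      HasFDerivAt.comp_hasDerivAt (f := fun t : ℂ => (t, (0 : ℂ))) 0 (hg j).hasFDerivAt hfst
    exact h1.unique ((hasDerivAt_const (0 : ℂ) (0 : ℂ)).congr_of_eventuallyEq hbj)
  have key : ∀ i, ∃ c > 0, ∀ᶠ x in 𝓝 (0 : ℂ × ℂ),
      eval (b x) (f i) = 0 → x.2 ≠ 0 → c * ‖x.1‖ ≤ ‖x.2‖ := by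
    intro i
    by_cases hi : eval p (f i) = 0
    · by_cases hij : i = j
      · subst hij
        refine ⟨1, one_pos, ?_⟩
        have := eventually_eq_zero_of_deriv_ne_zero (hg i) hbj (by simpa [hbw] using he)
        filter_upwards [this] with x hx h0 hne
        exact absurd (hx h0) hne
      · have hα : (gradCLM (f i) p).comp (fderiv ℂ b 0) (1, 0) ≠ 0 := fun h0 =>
          hv (huv ▸ isTangentDirection_of_gradCLM_eq_zero hp hij hi hj
            (hreg.not_proportional i j hij hi hj) h0 huj)
        obtain ⟨c, hc, h⟩ := exists_gap_of_deriv_ne_zero (hg i) (by rw [hb0, hi]) hα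
        exact ⟨c, hc, h.mono fun x hx h0 _ => hx h0⟩
    · refine ⟨1, one_pos, ?_⟩
      have hc : ContinuousAt (fun x => eval (b x) (f i)) 0 := (hg i).hasFDerivAt.continuousAt
      filter_upwards [hc.eventually_ne (by rwa [hb0])] with x hx h0
      exact absurd h0 hx
  choose c hc hev using key
  have hmin : ∃ c₀ > 0, ∀ i, c₀ ≤ c i := by
    have : ∀ᶠ c₀ in 𝓝[>] (0 : ℝ), ∀ i, c₀ ≤ c i :=
      eventually_all.2 fun i => nhdsWithin_le_nhds (Iic_mem_nhds (hc i))
    obtain ⟨c₀, h1, h2⟩ := (this.and self_mem_nhdsWithin).exists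
    exact ⟨c₀, h2, h1⟩
  obtain ⟨c₀, hc₀, hle⟩ := hmin
  refine ⟨c₀, hc₀, ?_⟩
  filter_upwards [eventually_all.2 hev] with x hx
  rintro ⟨i, hi⟩ hne
  exact (mul_le_mul_of_nonneg_right (hle i) (norm_nonneg _)).trans (hx i hi hne)

end

section

/-! ### The determinantal hypersurface of a tuple of matrices -/

variable {k N s : ℕ}

theorem eval_pencilPoly (A : Fin (k + 1) → Matrix (Fin N) (Fin N) ℂ) (y : Fin (k + 2) → ℂ) :
    eval y (pencilPoly A) =
      (∑ i : Fin (k + 1), y i.castSucc • A i - y (Fin.last (k + 1)) • 1).det := by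
  rw [pencilPoly, RingHom.map_det]
  congr 1
  ext a b
  by_cases h : a = b <;> simp [Matrix.sum_apply, h]

theorem eval_chartLast (R : MvPolynomial (Fin (k + 2)) ℂ) (x : Fin (k + 1) → ℂ) :
    eval x (chartLast R) = eval (Fin.snoc (α := fun _ => ℂ) x 1) R := by
  rw [chartLast, aeval_def, ← coe_eval₂Hom, ← RingHom.comp_apply]
  refine DFunLike.congr_fun (MvPolynomial.ringHom_ext (fun r => by simp) fun i => ?_) R
  refine Fin.lastCases ?_ (fun l => ?_) i <;> simp

theorem eval_chartFirst (R : MvPolynomial (Fin (k + 2)) ℂ) (x : Fin (k + 1) → ℂ) :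
    eval x (chartFirst R) = eval (Fin.cons (α := fun _ => ℂ) 1 x) R := by
  rw [chartFirst, aeval_def, ← coe_eval₂Hom, ← RingHom.comp_apply]
  refine DFunLike.congr_fun (MvPolynomial.ringHom_ext (fun r => by simp) fun i => ?_) R
  refine Fin.cases ?_ (fun l => ?_) i <;> simp

theorem IsIrreducibleFactorization.exists_eval_eq_zero {σ : Type} {F : MvPolynomial σ ℂ}
    {R : Fin s → MvPolynomial σ ℂ} {m : Fin s → ℕ} (h : IsIrreducibleFactorization F R m)
    {y : σ → ℂ} (hy : eval y F = 0) : ∃ j, eval y (R j) = 0 := by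
  obtain ⟨u, hu⟩ := h.associated_prod
  have h1 : eval y (∏ j, R j ^ m j) = 0 := by rw [← hu, map_mul, hy, zero_mul]
  rw [map_prod] at h1
  obtain ⟨j, -, hj⟩ := Finset.prod_eq_zero_iff.1 h1
  rw [map_pow] at hj
  exact ⟨j, eq_zero_of_pow_eq_zero hj⟩

/-- Both charts at once: `f` are the local equations of the components, `q(t)` is the point over
`t • v` of the graph of a branch `φ` of `{f j = 0}`, and `b(t, w)` is a deformation of `q(t)`,
transversal to `{f j = 0}`, that lies on the hypersurface whenever `μ + w` is an eigenvalue of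
`T t`. -/
theorem rieszProjectionExtends_of_deformation {d : Fin (k + 1)}
    {f : Fin s → MvPolynomial (Fin (k + 1)) ℂ} {z₀ : ℂ} (hreg : Regularity d f (point d z₀ 0))
    {v : Fin k → ℂ} (hv : ¬ IsTangentDirection d f (point d z₀ 0) v) {j : Fin s}
    (hj : eval (point d z₀ 0) (f j) = 0) {φ : (Fin k → ℂ) → ℂ} (hφ : IsBranch d (f j) z₀ φ)
    {b : ℂ × ℂ → Fin (k + 1) → ℂ} (hb : AnalyticAt ℂ b 0)
    (hbq : ∀ t, b (t, 0) = point d (φ (t • v)) (t • v))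
    {e : Fin (k + 1) → ℂ} (hbe : HasDerivAt (fun w => b (0, w)) e 0)
    (he : gradCLM (f j) (point d z₀ 0) e ≠ 0)
    {T : ℂ → Matrix (Fin N) (Fin N) ℂ} {μ : ℂ} (hT : ∀ a b, AnalyticAt ℂ (fun t => T t a b) 0)
    (hss : ∀ v, (T 0 - μ • 1).mulVec ((T 0 - μ • 1).mulVec v) = 0 →
      (T 0 - μ • 1).mulVec v = 0)
    (hspec : ∀ᶠ x in 𝓝 (0 : ℂ × ℂ), μ + x.2 ∈ spectrum ℂ (T x.1) →
      ∃ i, eval (b x) (f i) = 0) :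
    (∀ᶠ t in 𝓝[≠] (0 : ℂ), point d (φ (t • v)) (t • v) ∉
      singularLocus (localEquation f (point d z₀ 0))) ∧ RieszProjectionExtends T μ := by
  have hb0 : b 0 = point d z₀ 0 := by
    have := hbq 0
    rw [zero_smul, hφ.map_zero] at this
    exact this
  have hline : Tendsto (fun t : ℂ => t • v) (𝓝 0) (𝓝 0) := by
    have : Continuous fun t : ℂ => t • v := by fun_prop
    simpa using this.tendsto 0
  refine ⟨eventually_notMem_singularLocus hv (q := fun t => point d (φ (t • v)) (t • v)) ?_
    fun t => proj_point d _ _, ?_⟩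
  · have h1 : ContinuousAt (fun t : ℂ => b (t, 0)) 0 :=
      ContinuousAt.comp (f := fun t : ℂ => (t, (0 : ℂ))) (x := 0) hb.continuousAt (by fun_prop)
    have h2 := h1.tendsto
    simp only [hbq] at h2
    simpa [hφ.map_zero] using h2
  obtain ⟨c, hc, hgap⟩ := exists_gap hreg (proj_point d z₀ 0) hv hj hb hb0
    (fun t => by rw [hbq, proj_point])
    (by filter_upwards [hline.eventually hφ.eval_eq_zero] with t ht using by rw [hbq]; exact ht)
    hbe he
  refine rieszProjectionExtends_of_gap hT hss hc ?_
  obtain ⟨ρ, hρ, hball⟩ := Metric.eventually_nhds_iff.1 (hgap.and hspec)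
  have hsmall : ∀ᶠ t in 𝓝 (0 : ℂ), c * ‖t‖ < ρ ∧ ‖t‖ < ρ := by
    have h1 : Continuous fun t : ℂ => c * ‖t‖ := by fun_prop
    have h2 : Continuous fun t : ℂ => ‖t‖ := by fun_prop
    exact ((h1.tendsto 0).eventually_lt_const (by simpa using hρ)).and
      ((h2.tendsto 0).eventually_lt_const (by simpa using hρ))
  filter_upwards [nhdsWithin_le_nhds hsmall] with t ht w hw hne
  rcases lt_or_ge ‖w - μ‖ ρ with hlt | hge
  · obtain ⟨h1, h2⟩ := hball (y := (t, w - μ)) (by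
      rw [dist_eq_norm, sub_zero, Prod.norm_def]
      exact max_lt ht.2 hlt)
    exact h1 (h2 (by simpa using hw)) (sub_ne_zero.2 hne)
  · exact ht.1.le.trans hge

theorem analyticAt_comp_line {φ : (Fin k → ℂ) → ℂ} (hφ : AnalyticAt ℂ φ 0) (v : Fin k → ℂ) :
    AnalyticAt ℂ (fun t : ℂ => φ (t • v)) 0 := by
  have h1 : AnalyticAt ℂ (fun t : ℂ => t • v) 0 := analyticAt_id.smul analyticAt_const
  exact AnalyticAt.comp (g := φ) (f := fun t : ℂ => t • v) (by simpa using hφ) h1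

theorem analyticAt_sum_smul_apply (B : Fin k → Matrix (Fin N) (Fin N) ℂ) (v : Fin k → ℂ)
    (a b : Fin N) : AnalyticAt ℂ (fun t : ℂ => (∑ i, (t * v i) • B i) a b) 0 := by
  simp only [Matrix.sum_apply, Matrix.smul_apply, smul_eq_mul]
  exact Finset.analyticAt_fun_sum _ fun i _ =>
    (analyticAt_id.mul analyticAt_const).mul analyticAt_const

end

end JointSpectrum

end

theorem theorem1p1 {k N s : ℕ} (A : Fin (k + 1) → Matrix (Fin N) (Fin N) ℂ)
    (hA : IsStarNormal (A 0) ∨ JointSpectrum.IsDiagonalizable (A 0))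
    (R : Fin s → MvPolynomial (Fin (k + 2)) ℂ) (m : Fin s → ℕ)
    (hR : JointSpectrum.IsIrreducibleFactorization (JointSpectrum.pencilPoly A) R m)
    (lam : ℂ) (hlam : lam ∈ spectrum ℂ (A 0)) (xhat : Fin k → ℂ) :
    (lam ≠ 0 →
      JointSpectrum.Regularity 0 (fun j => JointSpectrum.chartLast (R j))
        (JointSpectrum.point 0 lam⁻¹ 0) →
      ¬ JointSpectrum.IsTangentDirection 0 (fun j => JointSpectrum.chartLast (R j))
        (JointSpectrum.point 0 lam⁻¹ 0) xhat →
      ∀ j, MvPolynomial.eval (JointSpectrum.point 0 lam⁻¹ 0)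
          (JointSpectrum.chartLast (R j)) = 0 →
        (∃ φ, JointSpectrum.IsBranch 0 (JointSpectrum.chartLast (R j)) lam⁻¹ φ) ∧
        ∀ φ, JointSpectrum.IsBranch 0 (JointSpectrum.chartLast (R j)) lam⁻¹ φ →
          (∀ᶠ t in 𝓝[≠] (0 : ℂ), JointSpectrum.point 0 (φ (t • xhat)) (t • xhat) ∉
            JointSpectrum.singularLocus (JointSpectrum.localEquation
              (fun i => JointSpectrum.chartLast (R i)) (JointSpectrum.point 0 lam⁻¹ 0))) ∧
          JointSpectrum.RieszProjectionExtends
            (fun t => φ (t • xhat) • A 0 + ∑ i : Fin k, (t * xhat i) • A i.succ) 1) ∧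
    (lam = 0 →
      JointSpectrum.Regularity (Fin.last k) (fun j => JointSpectrum.chartFirst (R j)) 0 →
      ¬ JointSpectrum.IsTangentDirection (Fin.last k)
        (fun j => JointSpectrum.chartFirst (R j)) 0 xhat →
      ∀ j, MvPolynomial.eval 0 (JointSpectrum.chartFirst (R j)) = 0 →
        (∃ φ, JointSpectrum.IsBranch (Fin.last k) (JointSpectrum.chartFirst (R j)) 0 φ) ∧
        ∀ φ, JointSpectrum.IsBranch (Fin.last k) (JointSpectrum.chartFirst (R j)) 0 φ →
          (∀ᶠ t in 𝓝[≠] (0 : ℂ),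
            JointSpectrum.point (Fin.last k) (φ (t • xhat)) (t • xhat) ∉
              JointSpectrum.singularLocus (JointSpectrum.localEquation
                (fun i => JointSpectrum.chartFirst (R i)) 0)) ∧
          JointSpectrum.RieszProjectionExtends
            (fun t => A 0 + ∑ i : Fin k, (t * xhat i) • A i.succ -
              φ (t • xhat) • (1 : Matrix (Fin N) (Fin N) ℂ)) 0) := by
  have hdet : ∀ (y : Fin (k + 2) → ℂ) (M : Matrix (Fin N) (Fin N) ℂ) (c w : ℂ),
      ∑ i : Fin (k + 1), y i.castSucc • A i - y (Fin.last (k + 1)) • 1 = c • (w • 1 - M) →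
      w ∈ spectrum ℂ M → ∃ i, MvPolynomial.eval y (R i) = 0 := by
    intro y M c w h hw
    refine hR.exists_eval_eq_zero ?_
    rw [JointSpectrum.eval_pencilPoly, h, Matrix.det_smul,
      JointSpectrum.mem_spectrum_iff_det.1 hw, mul_zero]
  refine ⟨fun hne hreg hv j hj => ⟨JointSpectrum.exists_isBranch hj (hreg.deriv_ne_zero j hj),
    fun φ hφ => ?_⟩, fun h0 hreg hv j hj => ?_⟩
  · have hφ' := JointSpectrum.analyticAt_comp_line hφ.analytic xhat
    -- an eigenvalue `1 + w` of the pencil corresponds to the point of the hypersurface obtained by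
    -- scaling with `(1 + w)⁻¹`, because the determinant is homogeneous
    refine JointSpectrum.rieszProjectionExtends_of_deformation hreg hv hj hφ
      (b := fun x => (1 + x.2)⁻¹ • JointSpectrum.point 0 (φ (x.1 • xhat)) (x.1 • xhat))
      (e := -JointSpectrum.point 0 lam⁻¹ 0) ?_ (fun t => by simp) ?_ ?_ (fun a b => ?_) ?_ ?_
    · have h1 : AnalyticAt ℂ (fun x : ℂ × ℂ => (1 + x.2)⁻¹) 0 :=
        (analyticAt_const.add analyticAt_snd).inv (by simp)
      refine h1.smul (JointSpectrum.analyticAt_point 0 ?_ (analyticAt_fst.smul analyticAt_const))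
      exact AnalyticAt.comp (g := fun t => φ (t • xhat)) (f := fun x : ℂ × ℂ => x.1) hφ'
        analyticAt_fst
    · have h1 : HasDerivAt (fun w : ℂ => (1 + w)⁻¹) (-1) 0 := by
        have := ((hasDerivAt_id' (0 : ℂ)).const_add 1).fun_inv (by simp)
        simpa using this
      have := h1.smul_const (JointSpectrum.point 0 (φ ((0 : ℂ) • xhat)) ((0 : ℂ) • xhat))
      simpa [hφ.map_zero] using this
    · rw [map_neg, JointSpectrum.gradCLM_point_zero]
      exact neg_ne_zero.2 (mul_ne_zero (inv_ne_zero hne) (hreg.deriv_ne_zero j hj))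
    · exact (hφ'.mul analyticAt_const).add (JointSpectrum.analyticAt_sum_smul_apply _ _ a b)
    · have hT0 : φ ((0 : ℂ) • xhat) • A 0 + ∑ i : Fin k, (0 * xhat i) • A i.succ - (1 : ℂ) • 1 =
          lam⁻¹ • (A 0 - lam • 1) := by
        simp [hφ.map_zero, smul_sub, smul_smul, inv_mul_cancel₀ hne]
      intro v hv0
      simp only [hT0, Matrix.smul_mulVec, Matrix.mulVec_smul] at hv0 ⊢
      rw [smul_eq_zero_iff_right (inv_ne_zero hne), smul_eq_zero_iff_right (inv_ne_zero hne)] at hv0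
      rw [JointSpectrum.mulVec_eq_zero_of_semisimple hA lam hv0, smul_zero]
    · have hev : ∀ᶠ x : ℂ × ℂ in 𝓝 0, 1 + x.2 ≠ 0 := by
        have : ContinuousAt (fun x : ℂ × ℂ => 1 + x.2) 0 := by fun_prop
        exact this.eventually_ne (by simp)
      filter_upwards [hev] with x hx hspec
      simp only [JointSpectrum.eval_chartLast]
      refine hdet _ _ (-(1 + x.2)⁻¹) _ ?_ hspec
      simp only [Fin.snoc_castSucc, Fin.snoc_last, Fin.sum_univ_succ]
      have e1 : ∀ i : Fin k, JointSpectrum.point 0 (φ (x.1 • xhat)) (x.1 • xhat) i.succ =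
          x.1 * xhat i := fun i => by simp [JointSpectrum.point]
      simp only [Pi.smul_apply, e1, smul_eq_mul, mul_smul, ← Finset.smul_sum]
      simp only [JointSpectrum.point, Fin.insertNth_apply_same]
      match_scalars <;> field_simp
  · subst h0
    have hp : (0 : Fin (k + 1) → ℂ) = JointSpectrum.point (Fin.last k) 0 0 := by
      ext i
      refine Fin.lastCases ?_ (fun l => ?_) i <;> simp [JointSpectrum.point]
    rw [hp] at hreg hv hj ⊢
    refine ⟨JointSpectrum.exists_isBranch hj (hreg.deriv_ne_zero j hj), fun φ hφ => ?_⟩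
    have hφ' := JointSpectrum.analyticAt_comp_line hφ.analytic xhat
    -- an eigenvalue `w` of the pencil corresponds to a shift of the last coordinate by `w`
    refine JointSpectrum.rieszProjectionExtends_of_deformation hreg hv hj hφ
      (b := fun x => JointSpectrum.point (Fin.last k) (φ (x.1 • xhat) + x.2) (x.1 • xhat))
      (e := JointSpectrum.point (Fin.last k) 1 0) ?_ (fun t => by simp) ?_ ?_ (fun a b => ?_) ?_ ?_
    · refine JointSpectrum.analyticAt_point _ (AnalyticAt.add ?_ analyticAt_snd)
        (analyticAt_fst.smul analyticAt_const)
      exact AnalyticAt.comp (g := fun t => φ (t • xhat)) (f := fun x : ℂ × ℂ => x.1) hφ'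
        analyticAt_fst
    · rw [hasDerivAt_pi]
      intro i
      refine Fin.lastCases ?_ (fun l => ?_) i
      · simpa [JointSpectrum.point] using (hasDerivAt_id' (0 : ℂ)).const_add (φ ((0 : ℂ) • xhat))
      · simpa [JointSpectrum.point] using hasDerivAt_const (0 : ℂ) (0 : ℂ)
    · rw [JointSpectrum.gradCLM_point_zero, one_mul]
      exact hreg.deriv_ne_zero j hj
    · exact (analyticAt_const.add (JointSpectrum.analyticAt_sum_smul_apply _ _ a b)).sub
        (hφ'.mul analyticAt_const)
    · intro v hv0
      have hT0 : A 0 + ∑ i : Fin k, ((0 : ℂ) * xhat i) • A i.succ -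
          φ ((0 : ℂ) • xhat) • (1 : Matrix (Fin N) (Fin N) ℂ) - (0 : ℂ) • 1 =
          A 0 - (0 : ℂ) • 1 := by
        simp [hφ.map_zero]
      simp only [hT0] at hv0 ⊢
      exact JointSpectrum.mulVec_eq_zero_of_semisimple hA 0 hv0
    · refine Eventually.of_forall fun x hspec => ?_
      simp only [JointSpectrum.eval_chartFirst]
      refine hdet _ _ (-1) _ ?_ hspec
      have e0 : (Fin.castSucc (0 : Fin (k + 1))) = 0 := rfl
      simp only [← Fin.succ_last, Fin.cons_succ, Fin.sum_univ_succ, ← Fin.succ_castSucc, e0,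
        Fin.cons_zero]
      simp only [JointSpectrum.point, Fin.insertNth_last', Fin.snoc_castSucc, Fin.snoc_last,
        Pi.smul_apply, smul_eq_mul]
      module
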